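/- **Setting.** A finite-horizon time-dependent MDP $\mathcal M$ has $S\ge 1$ states, $A\ge 1$ actions, horizon $H\ge 1$, transition probabilities $P_{h|s,a}(s')$ and rewards $r_h(s,a)\in[0,1]$, $0\le h<H$. For a policy $\pi:(s,h)\mapsto a$ let $V^\pi_h(s)=\mathbb E[\sum_{t=h}^{H-1} r_t(s_t,\pi(s_t,t))\mid s_h=s]$ and $V^*_h=\max_\pi V^\pi_h$; $\pi$ is optimal if $V_0^\pi=V_0^*$. A quantum oracle of $\mathcal M$ (with words of $q$ bits, $p$ of them fractional) is any unitary $O_{\mathcal{QM}}$ with $$O_{\mathcal{QM}}:|s\rangle|a\rangle|h\rangle|s'\rangle|0\rangle|0\rangle\mapsto|s\rangle|a\rangle|h\rangle|s'\rangle|r_h(s,a)\rangle|P_{h|s,a}(s')\rangle .$$ Query complexity is the worst-case number of calls of $O_{\mathcal{QM}}$ and $O_{\mathcal{QM}}^\dagger$. Similarly, a quantum oracle of a vector $f\in\mathbb R^N$ is any unitary $B_f$ with $|i\rangle|0\rangle\mapsto|i\rangle|f(i)\rangle$. $\mathbf{QMS}_\zeta$ (quantum maximum searching, $0<\zeta<1$)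 is a quantum algorithm that, for every exactly encoded $f\in\mathbb R^N$, $N\ge1$, and every quantum oracle $B_f$, returns an index of a maximum of $f$ with probability at least $1-\zeta$, using at most $\tilde c\sqrt N\max\{1,\log(1/\zeta)\}$ calls of $B_f$ and $B_f^\dagger$, where $\tilde c>0$ is an absolute constant. The algorithm $\mathbf{QVI\text{-}1}(\mathcal M,\delta)$, $\delta\in(0,1)$: put $\zeta=\delta/(SH)$ and $\hat V_H=0$; for $h=H-1,\dots,0$ create a quantum oracle of $\hat V_{h+1}$ and, for each $s$, create from it and $O_{\mathcal{QM}}$ a quantum oracle of $\hat Q_{h,s}(a)=r_h(s,a)+\sum_{s'}P_{h|s,a}(s')\hat V_{h+1}(s')$, let $\hat\pi(s,h)$ be the output of $\mathbf{QMS}_\zeta$ on $\hat Q_{h,s}$, and let $\hat V_h(s)=\hat Q_{h,s}(\hat\pi(s,h))$. The oracle of $\hat Q_{h,s}$ is built by computing the terms of the sum one after the other (query, accumulate, uncompute), and $\hat V,\hat Q$ are stored in registers that are long enough for exact arithmetic. Return $\hat\pi$ and $\hat V_0$. **Theorem.** There is a quantum maximum searching algorithm $\mathbf{QMS}$ as described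 such that $\mathbf{QVI\text{-}1}$, run with it, has the following properties. 1. Its query complexity with respect to $O_{\mathcal{QM}}$ is $O\bigl(S^2\sqrt A\,H\log(SH/\delta)\bigr)$: for every $\kappa>1$ there is $C>0$ such that for all $S,A,H\ge1$, all $p,q$, and all $\delta\in(0,1)$ with $SH/\delta\ge\kappa$, it makes at most $C\,S^2\sqrt A\,H\log(SH/\delta)$ queries. (With $\kappa=2$ the condition $SH/\delta\ge\kappa$ can fail only for $S=H=1$ and $\delta>1/2$.) 2. For every $\delta\in(0,1)$, every MDP whose rewards and transition probabilities are represented exactly with $q$ bits, $p$ of them fractional, and every quantum oracle of it, with probability at least $1-\delta$ the output $\hat\pi$ is an optimal policy and $\hat V_0=V_0^*$. In comparison, classical value iteration (backward induction) makes exactly $S^2AH$ queries to the classical oracle $(s,a,h,s')\mapsto(r_h(s,a),P_{h|s,a}(s'))$ to compute an optimal policy and $V_0^*$; so QVI-1 is a quadratic speedup in $A$. -/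

import Mathlib

namespace QVI

/-! ### Finite-horizon, time-dependent Markov decision processes -/

/-- A finite-horizon, time-dependent MDP with states `Fin S`, actions `Fin A` and time steps
`Fin H`: `P h s a x` is the probability of moving to `x` and `r h s a` the reward, when action
`a` is taken in state `s` at time `h`. -/
structure MDP (S A H : ℕ) where
  P : Fin H → Fin S → Fin A → Fin S → ℝ
  r : Fin H → Fin S → Fin A → ℝ
  P_nonneg : ∀ h s a x, 0 ≤ P h s a x
  P_sum : ∀ h s a, ∑ x, P h s a x = 1
  r_mem : ∀ h s a, r h s a ∈ Set.Icc (0 : ℝ) 1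

/-- A (deterministic, time-dependent) policy: `π s h` is the action taken in `s` at time `h`. -/
abbrev Policy (S A H : ℕ) : Type := Fin S → Fin H → Fin A

namespace MDP

variable {S A H : ℕ}

/-- The law of the state `s_{h+k}` when the process starts at time `h` in `s_h = s` and follows
the policy `π`. (Only times up to `H` matter; there are no transitions after that.) -/
noncomputable def stateLaw (M : MDP S A H) (π : Policy S A H) (h : ℕ) (s : Fin S) :
    ℕ → Fin S → ℝ
  | 0, x => if x = s then 1 else 0
  | k + 1, x => ∑ y, M.stateLaw π h s k y *
      (if hk : h + k < H then M.P ⟨h + k, hk⟩ y (π y ⟨h + k, hk⟩) x else 0)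

/-- `V^π_h(s) = E[∑_{t=h}^{H-1} r_t(s_t, π(s_t, t)) | π, s_h = s]`. -/
noncomputable def value (M : MDP S A H) (π : Policy S A H) (h : ℕ) (s : Fin S) : ℝ :=
  ∑ t : Fin H, if h ≤ (t : ℕ) then
    ∑ x, M.stateLaw π h s ((t : ℕ) - h) x * M.r t x (π x t) else 0

/-- `V^*_h(s) = max_π V^π_h(s)`, a maximum over the finite set of policies. -/
noncomputable def optValue (M : MDP S A H) (h : ℕ) (s : Fin S) : ℝ :=
  ⨆ π : Policy S A H, M.value π h s

/-- A policy `π` is optimal if `V^π_0 = V^*_0`. -/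
def IsOptimal (M : MDP S A H) (π : Policy S A H) : Prop :=
  ∀ s, M.value π 0 s = M.optValue 0 s

end MDP

/-! ### Quantum query algorithms

The pure states of a register with (finite) computational basis `W` are vectors `W → ℂ`; a
tensor factor of the register is singled out by a bijection `W ≃ T × T'` of the basis. -/

/-- The gates of a circuit on a register with basis `W`, with access to a unitary oracle acting on
a register with basis `R`:
* `unitary e U` applies the fixed unitary `U` to the tensor factor `T`;
* `perm σ` is the classical reversible gate `|w⟩ ↦ |σ w⟩`;
* `query e` / `queryInv e` apply the oracle / its inverse to the tensor factor `R`. -/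
inductive Gate (R W : Type) : Type 1
  | unitary {T X : Type} [Fintype T] [DecidableEq T] (e : W ≃ T × X)
      (U : Matrix.unitaryGroup T ℂ) : Gate R W
  | perm (σ : Equiv.Perm W) : Gate R W
  | query {X : Type} (e : W ≃ R × X) : Gate R W
  | queryInv {X : Type} (e : W ≃ R × X) : Gate R W

/-- The operator `U ⊗ I` on the register `W`, where `U` acts on the tensor factor `T`. -/
noncomputable def applyOn {W T X : Type} [Fintype T] (e : W ≃ T × X) (U : Matrix T T ℂ)
    (ψ : W → ℂ) : W → ℂ :=
  fun w => ∑ t, U (e w).1 t * ψ (e.symm (t, (e w).2))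

namespace Gate

variable {R W V X : Type}

/-- The action of a gate on states, the oracle being the unitary `O`. -/
noncomputable def apply [Fintype R] [DecidableEq R] (O : Matrix.unitaryGroup R ℂ) :
    Gate R W → (W → ℂ) → (W → ℂ)
  | unitary e U, ψ => applyOn e U.1 ψ
  | perm σ, ψ => fun w => ψ (σ.symm w)
  | query e, ψ => applyOn e O.1 ψ
  | queryInv e, ψ => applyOn e (star O.1) ψ

/-- Number of oracle calls of a gate; the oracle and its inverse both cost one query. -/
def cost : Gate R W → ℕ
  | unitary _ _ => 0
  | perm _ => 0
  | query _ => 1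
  | queryInv _ => 1

/-- The inverse gate. -/
def inv : Gate R W → Gate R W
  | unitary e U => unitary e (star U)
  | perm σ => perm σ.symm
  | query e => queryInv e
  | queryInv e => query e

/-- A gate on `W`, regarded as a gate on a larger register `V` with `W` as a tensor factor. -/
def lift (f : V ≃ W × X) : Gate R W → Gate R V
  | unitary e U => unitary
      ((f.trans (e.prodCongr (Equiv.refl X))).trans (Equiv.prodAssoc _ _ _)) U
  | perm σ => perm ((f.trans (σ.prodCongr (Equiv.refl X))).trans f.symm)
  | query e => query ((f.trans (e.prodCongr (Equiv.refl X))).trans (Equiv.prodAssoc _ _ _))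
  | queryInv e => queryInv ((f.trans (e.prodCongr (Equiv.refl X))).trans (Equiv.prodAssoc _ _ _))

end Gate

/-- A circuit: the gates are applied from left to right. -/
abbrev Circuit (R W : Type) : Type 1 := List (Gate R W)

namespace Circuit

variable {R W : Type}

/-- The action of a circuit on states, the oracle being the unitary `O`. -/
noncomputable def apply [Fintype R] [DecidableEq R] (O : Matrix.unitaryGroup R ℂ)
    (c : Circuit R W) (ψ : W → ℂ) : W → ℂ :=
  c.foldl (fun φ g => g.apply O φ) ψ

/-- Number of oracle calls of a circuit. -/
def cost (c : Circuit R W) : ℕ := (c.map Gate.cost).sum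

/-- The inverse circuit. -/
def inv (c : Circuit R W) : Circuit R W := (c.map Gate.inv).reverse

end Circuit

/-- A quantum query algorithm with classical control and result in `α`: either it stops with
a result, or it prepares a register with finite basis `W` in the basis state `|w₀⟩`, runs a
circuit on it, measures the register in the computational basis, and continues according to the
outcome. -/
inductive Prog (R : Type) (α : Type) : Type 1
  | done (a : α) : Prog R α
  | run (W : Type) [Fintype W] [DecidableEq W] (w₀ : W) (c : Circuit R W)
      (k : W → Prog R α) : Prog R α

namespace Prog

variable {R α β : Type}

/-- Sequential composition. -/
def bind : Prog R α → (α → Prog R β) → Prog R β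
  | done a, f => f a
  | run W w₀ c k, f => run W w₀ c (fun w => (k w).bind f)

instance : Monad (Prog R) where
  pure := Prog.done
  bind := Prog.bind

/-- The probability that the result satisfies `E`, the oracle being the unitary `O`. The outcome
`w` of a measurement of the state `ψ` has probability `‖ψ w‖ ^ 2`. -/
noncomputable def prob [Fintype R] [DecidableEq R] (O : Matrix.unitaryGroup R ℂ) (E : Set α) :
    Prog R α → ℝ
  | done a => E.indicator (fun _ => (1 : ℝ)) a
  | run _ w₀ c k => ∑ w, ‖c.apply O (Pi.single w₀ 1) w‖ ^ 2 * (k w).prob O E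

/-- The query complexity: the largest number of oracle calls, over all sequences of measurement
outcomes. -/
def queries : Prog R α → ℕ
  | done _ => 0
  | run _ _ c k => c.cost + Finset.univ.sup (fun w => (k w).queries)

end Prog

section Subst

variable {R Q Z : Type}

/-- The gates that replace a gate of an algorithm with oracle on `Q`, when the calls of that
oracle are carried out by the circuit `B` acting on `Q` and on an auxiliary register `Z`. -/
def Gate.subst (B : Circuit R (Q × Z)) {W : Type} : Gate Q W → Circuit R (W × Z)
  | @Gate.unitary _ _ _ _ _ _ e U => [(Gate.unitary e U : Gate R W).lift (Equiv.refl (W × Z))]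
  | .perm σ => [(Gate.perm σ : Gate R W).lift (Equiv.refl (W × Z))]
  | .query e => B.map (Gate.lift (regs e))
  | .queryInv e => B.inv.map (Gate.lift (regs e))
where
  /-- Regrouping of the registers. -/
  regs {W X : Type} (e : W ≃ Q × X) : W × Z ≃ (Q × Z) × X :=
    { toFun := fun w => (((e w.1).1, w.2), (e w.1).2)
      invFun := fun v => (e.symm (v.1.1, v.2), v.1.2)
      left_inv := fun w => by simp
      right_inv := fun v => by simp }

/-- Run an algorithm with oracle on `Q`, carrying out every call of its oracle by the circuit `B`
(and every call of the inverse oracle by the inverse circuit), where `B` uses an auxiliary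
register `Z` prepared in `|z₀⟩`. -/
def Prog.subst [Fintype Z] [DecidableEq Z] (B : Circuit R (Q × Z)) (z₀ : Z) {α : Type} :
    Prog Q α → Prog R α
  | .done a => .done a
  | @Prog.run _ _ W _ _ w₀ c k => .run (W × Z) (w₀, z₀) (c.flatMap (Gate.subst B))
      (fun w => (k w.1).subst B z₀)

end Subst

/-! ### Binary encodings and oracles -/

/-- The basis of a register of `q` qubits; the bit string `k₁ … k_q` is identified with the
number that it represents. -/
abbrev Word (q : ℕ) : Type := Fin (2 ^ q)

/-- The word of a natural number (modulo `2 ^ q`). -/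
def toWord (q n : ℕ) : Word q := Fin.ofNat (2 ^ q) n

/-- The fixed-point representation, with precision `2 ^ (-p)` and `q` bits, of a real `x ≥ 0`. -/
noncomputable def fix (p q : ℕ) (x : ℝ) : Word q := toWord q ⌊x * 2 ^ p⌋₊

/-- The real number represented by a word with `p` fractional bits. -/
noncomputable def unfix (p : ℕ) {q : ℕ} (w : Word q) : ℝ := ((w : ℕ) : ℝ) / 2 ^ p

/-- `x` is stored without rounding and without overflow in `q` bits, `p` of them fractional. -/
def Representable (p q : ℕ) (x : ℝ) : Prop := ∃ w : Word q, x = unfix p w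

/-- `B` is a quantum oracle encoding `f`: `B |i⟩|0⟩ = |i⟩|f(i)⟩`. Nothing is said about the other
basis states. -/
def IsBinaryOracle {N : ℕ} (p q : ℕ) (f : Fin N → ℝ)
    (B : Matrix.unitaryGroup (Fin N × Word q) ℂ) : Prop :=
  ∀ i, B.1.mulVec (Pi.single (i, 0) 1) = Pi.single (i, fix p q (f i)) 1

/-- The basis of the register `ℂ^S ⊗ ℂ^A ⊗ ℂ^H ⊗ ℂ^S ⊗ ℂ^(2^q) ⊗ ℂ^(2^q)`. -/
abbrev MReg (S A H q : ℕ) : Type := Fin S × Fin A × Fin H × Fin S × Word q × Word q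

/-- `O` is a quantum oracle of the MDP `M`:
`O |s⟩|a⟩|h⟩|x⟩|0⟩|0⟩ = |s⟩|a⟩|h⟩|x⟩|r_h(s,a)⟩|P_{h|s,a}(x)⟩`. -/
def IsQuantumOracle {S A H : ℕ} (p q : ℕ) (M : MDP S A H)
    (O : Matrix.unitaryGroup (MReg S A H q) ℂ) : Prop :=
  ∀ s a h x, O.1.mulVec (Pi.single (s, a, h, x, 0, 0) 1) =
    Pi.single (s, a, h, x, fix p q (M.r h s a), fix p q (M.P h s a x)) 1

/-- All rewards and transition probabilities are stored exactly by the oracle. -/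
def MDP.Representable {S A H : ℕ} (M : MDP S A H) (p q : ℕ) : Prop :=
  (∀ h s a, QVI.Representable p q (M.r h s a)) ∧
    ∀ h s a x, QVI.Representable p q (M.P h s a x)

/-! ### Quantum maximum searching -/

/-- A family of quantum query algorithms, one for every list length `N ≥ 1`, word length `q` and
failure probability `ζ`, which query an oracle for a vector of `N` words and return an index. -/
abbrev MaxSearch : Type 1 :=
  ∀ (N : ℕ) [NeZero N] (q : ℕ), ℝ → Prog (Fin N × Word q) (Fin N)

/-- `QMS` is a quantum maximum searching algorithm with constant `c`: for every `ζ ∈ (0,1)` it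
uses at most `c √N max(1, log(1/ζ))` queries to the oracle and, for every vector and every
quantum oracle encoding it, returns the index of a maximum with probability at least `1 - ζ`. -/
def IsQMS (QMS : MaxSearch) (c : ℝ) : Prop :=
  0 < c ∧ ∀ (N : ℕ) [NeZero N] (q : ℕ) (ζ : ℝ), 0 < ζ → ζ < 1 →
    ((QMS N q ζ).queries : ℝ) ≤ c * √(N : ℝ) * max 1 (Real.log (1 / ζ)) ∧
    ∀ (p : ℕ) (f : Fin N → ℝ), (∀ i, Representable p q (f i)) →
      ∀ B : Matrix.unitaryGroup (Fin N × Word q) ℂ, IsBinaryOracle p q f B →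
        1 - ζ ≤ (QMS N q ζ).prob B {i | ∀ j, f j ≤ f i}

/-! ### The algorithm QVI-1 -/

section QVI1

variable (S A H p q : ℕ) [NeZero S] [NeZero A] [NeZero H]

/-- Number of fractional bits of the registers for `V̂` and `Q̂`: enough to compute exactly with
transition probabilities and rewards that have `p` fractional bits. -/
abbrev fracBits (H p : ℕ) : ℕ := p * H

/-- Number of bits of the registers for `V̂` and `Q̂`: enough for numbers in `[0, H]`. -/
abbrev wordBits (H p : ℕ) : ℕ := p * H + H

/-- The register of the oracle for `Q̂_{h,s}`: an action and an output word. -/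
abbrev QReg : Type := Fin A × Word (wordBits H p)

/-- The auxiliary register: the register of the oracle of the MDP, and a word for an entry
of `V̂`. -/
abbrev Aux : Type := MReg S A H q × Word (wordBits H p)

/-- All auxiliary registers in `|0⟩`. -/
def aux0 : Aux S A H p q := ((0, 0, 0, 0, 0, 0), 0)

variable {S A H p q}

/-- Writes `s`, the action in the action register, `h` and `x` into the index registers of the
oracle of the MDP, if these are in `|0⟩`. (It exchanges `|0⟩` with the value to be written, so
that it is its own inverse.) -/
def loadFun (s : Fin S) (h : Fin H) (x : Fin S) :
    QReg A H p × Aux S A H p q → QReg A H p × Aux S A H p q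
  | ((a, y), ((s₁, a₁, h₁, x₁, u, w), v)) =>
    ((a, y), ((Equiv.swap 0 s s₁, Equiv.swap 0 a a₁, Equiv.swap 0 h h₁, Equiv.swap 0 x x₁,
      u, w), v))

/-- The gate that loads `(s, a, h, x)`, where `a` is the content of the action register. -/
def load (s : Fin S) (h : Fin H) (x : Fin S) : Equiv.Perm (QReg A H p × Aux S A H p q) where
  toFun := loadFun s h x
  invFun := loadFun s h x
  left_inv z := by simp [loadFun]
  right_inv z := by simp [loadFun]

/-- The quantum oracle for the (classically known) vector `V̂`, as a classical reversible gate: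
`|x⟩|v⟩ ↦ |x⟩|v + V̂(x)⟩` on the next-state register and the `V̂` register. -/
def oracleV (V : Fin S → Word (wordBits H p)) :
    Equiv.Perm (QReg A H p × Aux S A H p q) where
  toFun z := (z.1, (z.2.1, z.2.2 + V z.2.1.2.2.2.1))
  invFun z := (z.1, (z.2.1, z.2.2 - V z.2.1.2.2.2.1))
  left_inv z := by simp
  right_inv z := by simp

/-- Adds the product of the probability register and the `V̂` register to the output word. -/
def mulAdd : Equiv.Perm (QReg A H p × Aux S A H p q) where
  toFun z := ((z.1.1, z.1.2 + toWord _ ((z.2.1.2.2.2.2.2 : ℕ) * (z.2.2 : ℕ) / 2 ^ p)), z.2)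
  invFun z := ((z.1.1, z.1.2 - toWord _ ((z.2.1.2.2.2.2.2 : ℕ) * (z.2.2 : ℕ) / 2 ^ p)), z.2)
  left_inv z := by simp
  right_inv z := by simp

/-- Adds the reward register to the output word. -/
def rewardAdd : Equiv.Perm (QReg A H p × Aux S A H p q) where
  toFun z := ((z.1.1, z.1.2 + toWord _ ((z.2.1.2.2.2.2.1 : ℕ) * 2 ^ (fracBits H p - p))), z.2)
  invFun z := ((z.1.1, z.1.2 - toWord _ ((z.2.1.2.2.2.2.1 : ℕ) * 2 ^ (fracBits H p - p))), z.2)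
  left_inv z := by simp
  right_inv z := by simp

/-- Regrouping of the registers that singles out the register of the oracle of the MDP. -/
def mregs : QReg A H p × Aux S A H p q ≃ MReg S A H q × (QReg A H p × Word (wordBits H p)) where
  toFun z := (z.2.1, (z.1, z.2.2))
  invFun z := (z.2.1, (z.1, z.2.2))
  left_inv _ := rfl
  right_inv _ := rfl

/-- The circuit for the quantum oracle of the vector
`Q̂_{h,s}(a) = r_h(s,a) + ∑ₓ P_{h|s,a}(x) V̂(x)`, built from the oracle of the MDP and the oracle
of `V̂`: every term is computed into auxiliary registers, added to the output word, and
uncomputed. -/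
def oracleQ (V : Fin S → Word (wordBits H p)) (h : Fin H) (s : Fin S) :
    Circuit (MReg S A H q) (QReg A H p × Aux S A H p q) :=
  ((List.finRange S).flatMap fun x =>
    [.perm (load s h x), .query mregs, .perm (oracleV V), .perm mulAdd,
      .perm (oracleV V).symm, .queryInv mregs, .perm (load s h x).symm]) ++
  [.perm (load s h 0), .query mregs, .perm rewardAdd, .queryInv mregs,
    .perm (load s h 0).symm]

/-- Evaluation of `Q̂_{h,s}(a)`: apply the oracle to `|a⟩|0⟩` and read off the output word. -/
def evalQ (V : Fin S → Word (wordBits H p)) (h : Fin H) (s : Fin S) (a : Fin A) :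
    Prog (MReg S A H q) (Word (wordBits H p)) :=
  .run (QReg A H p × Aux S A H p q) ((a, 0), aux0 S A H p q) (oracleQ V h s)
    (fun z => .done z.1.2)

/-- Time step `h` of QVI-1: from `V = V̂_{h+1}` (and the policy at later times) compute, one state
after the other, `π̂(s,h)` by maximum searching on `Q̂_{h,s}`, with failure probability `ζ`, and
`V̂_h(s) = Q̂_{h,s}(π̂(s,h))`. -/
noncomputable def qviStep (QMS : MaxSearch) (ζ : ℝ) (h : Fin H)
    (st : Policy S A H × (Fin S → Word (wordBits H p))) :
    Prog (MReg S A H q) (Policy S A H × (Fin S → Word (wordBits H p))) :=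
  (List.finRange S).foldlM (fun acc s => do
    let a ← (QMS A (wordBits H p) ζ).subst (oracleQ st.2 h s) (aux0 S A H p q)
    let v ← evalQ st.2 h s a
    pure (Function.update acc.1 s (Function.update (acc.1 s) h a),
      Function.update acc.2 s v)) st

variable (S A H p q)

/-- **QVI-1**, with the maximum searching algorithm `QMS` and maximum failure probability `δ`, for
an MDP with `S` states, `A` actions and horizon `H` whose oracle has words of `q` bits with `p`
fractional bits: `ζ = δ/(SH)`, `V̂_H = 0`, and `h = H-1, …, 0`. It returns `π̂` and `V̂_0`. -/
noncomputable def QVI1 (QMS : MaxSearch) (δ : ℝ) :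
    Prog (MReg S A H q) (Policy S A H × (Fin S → Word (wordBits H p))) :=
  (List.finRange H).reverse.foldlM (fun st h => qviStep QMS (δ / (S * H)) h st)
    (fun _ _ => 0, fun _ => 0)

end QVI1

/-- The outputs `(π̂, V̂_0)` of QVI-1 for which `π̂` is an optimal policy and `V̂_0 = V^*_0`. -/
def correctOutputs {S A H p : ℕ} (M : MDP S A H) :
    Set (Policy S A H × (Fin S → Word (wordBits H p))) :=
  {out | M.IsOptimal out.1 ∧ ∀ s, unfix (fracBits H p) (out.2 s) = M.optValue 0 s}

/-! ### Classical value iteration -/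

/-- A classical algorithm with queries in `I`, answers in `J` and result in `α`. -/
inductive CProg (I J α : Type) : Type
  | done (a : α) : CProg I J α
  | ask (i : I) (k : J → CProg I J α) : CProg I J α

namespace CProg

variable {I J α β : Type}

def bind : CProg I J α → (α → CProg I J β) → CProg I J β
  | done a, f => f a
  | ask i k, f => ask i (fun j => (k j).bind f)

instance : Monad (CProg I J) where
  pure := CProg.done
  bind := CProg.bind

/-- The result, when queries are answered by `O`. -/
def eval (O : I → J) : CProg I J α → α
  | done a => a
  | ask i k => (k (O i)).eval O

/-- The number of queries, when they are answered by `O`. -/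
def queries (O : I → J) : CProg I J α → ℕ
  | done _ => 0
  | ask i k => (k (O i)).queries O + 1

end CProg

/-- The classical oracle `(s, a, h, x) ↦ (r_h(s,a), P_{h|s,a}(x))` of an MDP. -/
def MDP.oracle {S A H : ℕ} (M : MDP S A H) (i : Fin S × Fin A × Fin H × Fin S) : ℝ × ℝ :=
  (M.r i.2.2.1 i.1 i.2.1, M.P i.2.2.1 i.1 i.2.1 i.2.2.2)

section VI

variable {S A H : ℕ} [NeZero A]

/-- An index at which `f` is maximal. -/
noncomputable def argmax (f : Fin A → ℝ) : Fin A := (Finite.exists_max f).choose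

/-- Computes `r_h(s,a) + ∑ₓ P_{h|s,a}(x) V(x)`. -/
noncomputable def viQ (V : Fin S → ℝ) (h : Fin H) (s : Fin S) (a : Fin A) :
    CProg (Fin S × Fin A × Fin H × Fin S) (ℝ × ℝ) ℝ := do
  let acc ← (List.finRange S).foldlM (fun (acc : ℝ × ℝ) x =>
    CProg.ask (s, a, h, x) (fun j => CProg.done (j.1, acc.2 + j.2 * V x))) (0, 0)
  pure (acc.1 + acc.2)

/-- Time step `h` of classical value iteration. -/
noncomputable def viStep (h : Fin H) (st : Policy S A H × (Fin S → ℝ)) :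
    CProg (Fin S × Fin A × Fin H × Fin S) (ℝ × ℝ) (Policy S A H × (Fin S → ℝ)) :=
  (List.finRange S).foldlM (fun acc s => do
    let Q ← (List.finRange A).foldlM (fun (Q : Fin A → ℝ) a => do
      let v ← viQ st.2 h s a
      pure (Function.update Q a v)) (fun _ => 0)
    pure (Function.update acc.1 s (Function.update (acc.1 s) h (argmax Q)),
      Function.update acc.2 s (Q (argmax Q)))) st

variable (S A H)

/-- Classical value iteration (backward induction). It returns `π` and `V_0`. -/
noncomputable def classicalVI :
    CProg (Fin S × Fin A × Fin H × Fin S) (ℝ × ℝ) (Policy S A H × (Fin S → ℝ)) :=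
  (List.finRange H).reverse.foldlM (fun st h => viStep h st) (fun _ _ => 0, fun _ => 0)

end VI

end QVI

/-!
The value part is backward induction. A policy `π` satisfies the Bellman equation
`V^π_h(s) = r_h(s, π(s,h)) + ∑ₓ P_{h|s,π(s,h)}(x) V^π_{h+1}(x)` (`MDP.value_eq_qval`), so a policy
from which no one-step deviation is profitable dominates every policy
(`MDP.GreedyFrom.value_le`). Time step `h` of value iteration, classical or quantum, therefore only
has to replace the actions at time `h` by maximizers of `Q̂_{h,s}` (`MDP.StepInvariant`,
`MDP.SolvedFrom`).

The quantum part needs a maximum searching algorithm that succeeds for every unitary with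
`|i⟩|0⟩ ↦ |i⟩|F i⟩`. Grover iterations query the oracle, flip signs and undo the query, so they
never leave the span of the known basis states, and `j` of them rotate the uniform state to the angle
`(2j + 1) θ`, where `sin² θ = t / N` and `t` is the number of marked indices
(`groverStep_iterate`). The search keeps the best entry found so far and marks the larger ones.
It uses a fixed schedule: stage `i` starts with `t < N / 4 ^ i` and aims at `t < N / 4 ^ (i + 1)`.
As long as the aim is not reached, `t / N` is known up to a factor of `4`, so a fixed number
`2 ^ i / 2` of iterations hits a marked index with probability at least `1 / 16`. That index is
uniformly distributed over the marked ones, and is in their top quarter with probability at least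
`1 / 4` (`le_prob_improve`). Stage `i` of `K = ⌈log₄ N⌉` makes `L (K - i)` attempts: since the cost
of an attempt grows geometrically with `i`, the total cost is `O(L 2 ^ K) = O(L √N)`, while the failure
probabilities of the stages sum up to `O((63 / 64) ^ L)`. With `L` of order `log (2 / ζ)` this gives
`isQMS_maxSearch`.

The circuit `oracleQ` acts as `|a⟩|y⟩ ↦ |a⟩|y + Q̂_{h,s}(a)⟩` when its auxiliary registers are in
`|0⟩`, and returns them to `|0⟩` (`oracleQ_withAux`), so it may be substituted for a genuine oracle
(`Prog.prob_subst`). The arithmetic is exact because `V̂_h` has only `p (H - h)` fractional bits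
(`MDP.sum_words_eq_fix_qval`). A union bound over the `S H` searches gives the failure
probability `δ`, and each call of `oracleQ` costs `2 S + 2` queries.
-/

namespace QVI

/-! ### Operators on a tensor factor -/

section ApplyOn

variable {W T X : Type} [Fintype T] (e : W ≃ T × X)

theorem applyOn_add (U : Matrix T T ℂ) (φ ψ : W → ℂ) :
    applyOn e U (φ + ψ) = applyOn e U φ + applyOn e U ψ := by
  funext w
  simp [applyOn, mul_add, Finset.sum_add_distrib]

theorem applyOn_smul (U : Matrix T T ℂ) (a : ℂ) (ψ : W → ℂ) :
    applyOn e U (a • ψ) = a • applyOn e U ψ := by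
  funext w
  simp only [applyOn, Pi.smul_apply, smul_eq_mul, Finset.mul_sum]
  exact Finset.sum_congr rfl fun t _ => by ring

theorem applyOn_mul (U V : Matrix T T ℂ) (ψ : W → ℂ) :
    applyOn e (U * V) ψ = applyOn e U (applyOn e V ψ) := by
  funext w
  simp only [applyOn, Matrix.mul_apply, Equiv.apply_symm_apply, Finset.sum_mul, Finset.mul_sum]
  rw [Finset.sum_comm]
  exact Finset.sum_congr rfl fun t _ => Finset.sum_congr rfl fun s _ => by ring

variable [DecidableEq T]

theorem applyOn_one (ψ : W → ℂ) : applyOn e (1 : Matrix T T ℂ) ψ = ψ := by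
  funext w
  simp [applyOn, Matrix.one_apply]

theorem applyOn_single [DecidableEq W] {U : Matrix T T ℂ} {t t' : T}
    (hU : U.mulVec (Pi.single t 1) = Pi.single t' 1) {w : W} (hw : (e w).1 = t) :
    applyOn e U (Pi.single w 1) = Pi.single (e.symm (t', (e w).2)) 1 := by
  subst hw
  have hent : ∀ s, U s (e w).1 = if s = t' then 1 else 0 := fun s => by
    have := congrFun hU s
    simpa [Pi.single_apply] using this
  funext w'
  simp only [applyOn, Pi.single_apply]
  rw [Finset.sum_eq_single (e w).1]
  · rw [hent]
    by_cases h : w' = e.symm (t', (e w).2)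
    · subst h
      simp
    · rw [if_neg h]
      by_cases h1 : (e w').1 = t'
      · rw [if_pos h1, if_neg, mul_zero]
        intro h2
        apply h
        have h3 : e w = ((e w).1, (e w').2) := (e.symm_apply_eq.1 h2).symm
        have h4 : (e w').2 = (e w).2 := (congrArg Prod.snd h3).symm
        rw [← h4, ← h1]
        simp
      · rw [if_neg h1, zero_mul]
  · intro s _ hs
    rw [if_neg, mul_zero]
    intro h2
    apply hs
    rw [← h2]
    simp
  · simp

theorem sum_normSq_mulVec {U : Matrix T T ℂ} (hU : star U * U = 1) (v : T → ℂ) :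
    ∑ t, ‖U.mulVec v t‖ ^ 2 = ∑ t, ‖v t‖ ^ 2 := by
  have key : ∀ u : T → ℂ, ((∑ t, ‖u t‖ ^ 2 : ℝ) : ℂ) = star u ⬝ᵥ u := fun u => by
    simp only [dotProduct, Pi.star_apply, RCLike.star_def, Complex.conj_mul']
    push_cast
    rfl
  apply Complex.ofReal_injective
  rw [key, key, Matrix.star_mulVec, Matrix.dotProduct_mulVec, Matrix.vecMul_vecMul,
    ← Matrix.star_eq_conjTranspose, hU, Matrix.vecMul_one]

theorem sum_normSq_applyOn [Fintype W] {U : Matrix T T ℂ} (hU : star U * U = 1)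
    (ψ : W → ℂ) : ∑ w, ‖applyOn e U ψ w‖ ^ 2 = ∑ w, ‖ψ w‖ ^ 2 := by
  cases isEmpty_or_nonempty T with
  | inl h =>
    have : IsEmpty W := e.isEmpty
    simp
  | inr h =>
    obtain ⟨t₀⟩ := h
    -- The complementary factor is not assumed to be finite, but embeds into `W`.
    have : Finite X := Finite.of_injective (fun x => e.symm (t₀, x)) fun x y hxy => by
      simpa using hxy
    have := Fintype.ofFinite X
    rw [← e.symm.sum_comp, ← e.symm.sum_comp, Fintype.sum_prod_type_right,
      Fintype.sum_prod_type_right]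
    refine Finset.sum_congr rfl fun x _ => ?_
    refine Eq.trans ?_ (sum_normSq_mulVec hU fun t => ψ (e.symm (t, x)))
    simp [applyOn, Matrix.mulVec, dotProduct]

end ApplyOn

/-! ### Gates and circuits -/

section Circuits

variable {R W V X : Type} [Fintype R] [DecidableEq R] (O : Matrix.unitaryGroup R ℂ)

/-- The action of a gate as a linear map. -/
noncomputable def Gate.toLin (g : Gate R W) : (W → ℂ) →ₗ[ℂ] (W → ℂ) where
  toFun := g.apply O
  map_add' φ ψ := by
    cases g <;> first | exact applyOn_add _ _ _ _ | rfl
  map_smul' a ψ := by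
    cases g <;> first | exact applyOn_smul _ _ _ _ | rfl

@[simp] theorem Circuit.apply_nil (ψ : W → ℂ) : Circuit.apply O ([] : Circuit R W) ψ = ψ := rfl

@[simp] theorem Circuit.apply_cons (g : Gate R W) (c : Circuit R W) (ψ : W → ℂ) :
    Circuit.apply O (g :: c) ψ = Circuit.apply O c (g.apply O ψ) := rfl

theorem Circuit.apply_append (c d : Circuit R W) (ψ : W → ℂ) :
    Circuit.apply O (c ++ d) ψ = Circuit.apply O d (Circuit.apply O c ψ) :=
  List.foldl_append

theorem Circuit.exists_linearMap (c : Circuit R W) :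
    ∃ L : (W → ℂ) →ₗ[ℂ] (W → ℂ), ∀ ψ, c.apply O ψ = L ψ := by
  induction c with
  | nil => exact ⟨LinearMap.id, fun _ => rfl⟩
  | cons g c ih =>
    obtain ⟨L, hL⟩ := ih
    exact ⟨L.comp (g.toLin O), fun ψ => hL _⟩

theorem Gate.sum_normSq_apply [Fintype W] (g : Gate R W) (ψ : W → ℂ) :
    ∑ w, ‖g.apply O ψ w‖ ^ 2 = ∑ w, ‖ψ w‖ ^ 2 := by
  cases g with
  | unitary e U => exact sum_normSq_applyOn e (Matrix.mem_unitaryGroup_iff'.1 U.2) ψ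
  | perm σ => exact σ.symm.sum_comp fun w => ‖ψ w‖ ^ 2
  | query e => exact sum_normSq_applyOn e (Matrix.mem_unitaryGroup_iff'.1 O.2) ψ
  | queryInv e =>
    exact sum_normSq_applyOn e (Matrix.mem_unitaryGroup_iff'.1 (star O).2) ψ

theorem Circuit.sum_normSq_apply [Fintype W] (c : Circuit R W) (ψ : W → ℂ) :
    ∑ w, ‖c.apply O ψ w‖ ^ 2 = ∑ w, ‖ψ w‖ ^ 2 := by
  induction c generalizing ψ with
  | nil => rfl
  | cons g c ih => rw [Circuit.apply_cons, ih, g.sum_normSq_apply]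

theorem Gate.inv_apply_apply (g : Gate R W) (ψ : W → ℂ) :
    g.inv.apply O (g.apply O ψ) = ψ := by
  cases g with
  | unitary e U =>
    change applyOn e (star U.1) (applyOn e U.1 ψ) = ψ
    rw [← applyOn_mul, Matrix.mem_unitaryGroup_iff'.1 U.2, applyOn_one]
  | perm σ =>
    funext w
    change ψ (σ.symm (σ w)) = ψ w
    rw [σ.symm_apply_apply]
  | query e =>
    change applyOn e (star O.1) (applyOn e O.1 ψ) = ψ
    rw [← applyOn_mul, Matrix.mem_unitaryGroup_iff'.1 O.2, applyOn_one]
  | queryInv e =>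
    change applyOn e O.1 (applyOn e (star O.1) ψ) = ψ
    rw [← applyOn_mul, Matrix.mem_unitaryGroup_iff.1 O.2, applyOn_one]

theorem Circuit.inv_apply_apply (c : Circuit R W) (ψ : W → ℂ) :
    c.inv.apply O (c.apply O ψ) = ψ := by
  induction c generalizing ψ with
  | nil => rfl
  | cons g c ih =>
    have h : Circuit.inv (g :: c) = Circuit.inv c ++ [g.inv] := by simp [Circuit.inv]
    rw [h, Circuit.apply_append, Circuit.apply_cons, Circuit.apply_cons, ih]
    exact g.inv_apply_apply O ψ

/-- A lifted gate acts on every slice of the state along the additional register. -/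
theorem Gate.lift_apply (f : V ≃ W × X) (g : Gate R W) (ψ : V → ℂ) (v : V) :
    (g.lift f).apply O ψ v = g.apply O (fun w => ψ (f.symm (w, (f v).2))) (f v).1 := by
  cases g <;> simp [Gate.lift, Gate.apply, applyOn, Prod.map]

theorem Circuit.lift_apply (f : V ≃ W × X) (c : Circuit R W) (ψ : V → ℂ) (v : V) :
    Circuit.apply O (c.map (Gate.lift f)) ψ v =
      c.apply O (fun w => ψ (f.symm (w, (f v).2))) (f v).1 := by
  induction c generalizing ψ with
  | nil => simp
  | cons g c ih =>
    rw [List.map_cons, Circuit.apply_cons, ih, Circuit.apply_cons]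
    congr 1
    funext w
    simp [Gate.lift_apply]

end Circuits

section Cost

variable {R W V X : Type}

theorem Circuit.cost_cons (g : Gate R W) (c : Circuit R W) :
    Circuit.cost (g :: c) = g.cost + Circuit.cost c := by
  simp [Circuit.cost]

theorem Circuit.cost_append (c d : Circuit R W) :
    Circuit.cost (c ++ d) = Circuit.cost c + Circuit.cost d := by
  simp [Circuit.cost]

theorem Circuit.cost_inv (c : Circuit R W) : c.inv.cost = c.cost := by
  have h : ∀ g : Gate R W, g.inv.cost = g.cost := fun g => by cases g <;> rfl
  simp [Circuit.cost, Circuit.inv, List.sum_reverse, Function.comp_def, h]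

theorem Circuit.cost_lift (f : V ≃ W × X) (c : Circuit R W) :
    Circuit.cost (c.map (Gate.lift f)) = c.cost := by
  have h : ∀ g : Gate R W, (g.lift f).cost = g.cost := fun g => by cases g <;> rfl
  simp [Circuit.cost, Function.comp_def, h]

end Cost

/-! ### Expectations and query counts of programs -/

namespace Prog

section Expectation

variable {R α β : Type} [Fintype R] [DecidableEq R] (O : Matrix.unitaryGroup R ℂ)

/-- The expected value of `g` at the result of a program. -/
noncomputable def expect (g : α → ℝ) : Prog R α → ℝ
  | done a => g a
  | run _ w₀ c k => ∑ w, ‖c.apply O (Pi.single w₀ 1) w‖ ^ 2 * (k w).expect g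

theorem prob_eq_expect (p : Prog R α) (E : Set α) :
    p.prob O E = p.expect O (E.indicator fun _ => 1) := by
  induction p with
  | done a => rfl
  | run W w₀ c k ih => simp only [prob, expect, ih]

theorem expect_bind (p : Prog R α) (f : α → Prog R β) (g : β → ℝ) :
    (p.bind f).expect O g = p.expect O fun a => (f a).expect O g := by
  induction p with
  | done a => rfl
  | run W w₀ c k ih => simp only [bind, expect, ih]

theorem expect_mono (p : Prog R α) {g g' : α → ℝ} (h : ∀ a, g a ≤ g' a) :
    p.expect O g ≤ p.expect O g' := by
  induction p with
  | done a => exact h a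
  | run W w₀ c k ih =>
    exact Finset.sum_le_sum fun w _ => mul_le_mul_of_nonneg_left (ih w) (by positivity)

theorem expect_add (p : Prog R α) (g g' : α → ℝ) :
    p.expect O (fun a => g a + g' a) = p.expect O g + p.expect O g' := by
  induction p with
  | done a => rfl
  | run W w₀ c k ih => simp only [expect, ih, mul_add, Finset.sum_add_distrib]

theorem expect_mul_left (p : Prog R α) (x : ℝ) (g : α → ℝ) :
    p.expect O (fun a => x * g a) = x * p.expect O g := by
  induction p with
  | done a => rfl
  | run W w₀ c k ih =>
    simp only [expect, ih, Finset.mul_sum]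
    exact Finset.sum_congr rfl fun w _ => by ring

theorem expect_const (p : Prog R α) (x : ℝ) : p.expect O (fun _ => x) = x := by
  induction p with
  | done a => rfl
  | run W w₀ c k ih =>
    simp only [expect, ih]
    rw [← Finset.sum_mul, c.sum_normSq_apply, Finset.sum_eq_single w₀]
    · simp
    · intro w _ hw
      simp [hw]
    · simp

theorem prob_nonneg (p : Prog R α) (E : Set α) : 0 ≤ p.prob O E := by
  rw [prob_eq_expect, ← p.expect_const O 0]
  exact p.expect_mono O fun a => Set.indicator_nonneg (fun _ _ => zero_le_one) a

theorem prob_le_one (p : Prog R α) (E : Set α) : p.prob O E ≤ 1 := by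
  rw [prob_eq_expect, ← p.expect_const O 1]
  refine p.expect_mono O fun a => ?_
  rw [p.expect_const O 1]
  exact Set.indicator_le_self' (fun _ _ => zero_le_one) a

theorem prob_mono (p : Prog R α) {E F : Set α} (h : E ⊆ F) : p.prob O E ≤ p.prob O F := by
  rw [prob_eq_expect, prob_eq_expect]
  exact p.expect_mono O fun a =>
    Set.indicator_le_indicator_of_subset h (fun _ => zero_le_one) a

theorem prob_done_of_mem {a : α} {E : Set α} (h : a ∈ E) : (done a : Prog R α).prob O E = 1 := by
  simp [prob, h]

/-- Two-step lower bound: the first step ends in `F` surely, and in `G` with probability at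
least `c`; the second step succeeds with probability at least `s` from `F` and surely from
`G`. -/
theorem le_prob_bind_of_subset (p : Prog R α) (f : α → Prog R β) {E : Set β} {F G : Set α}
    (hGF : G ⊆ F) {c s : ℝ} (hs : s ≤ 1) (hF : 1 ≤ p.prob O F) (hG : c ≤ p.prob O G)
    (hfF : ∀ a ∈ F, s ≤ (f a).prob O E) (hfG : ∀ a ∈ G, 1 ≤ (f a).prob O E) :
    s + (1 - s) * c ≤ (p.bind f).prob O E := by
  have hF1 : p.prob O F = 1 := le_antisymm (p.prob_le_one O F) hF
  have key : p.expect O (fun a => s * F.indicator (fun _ => 1) a +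
      (1 - s) * G.indicator (fun _ => 1) a) ≤ (p.bind f).prob O E := by
    rw [prob_eq_expect, expect_bind]
    refine p.expect_mono O fun a => ?_
    rw [← prob_eq_expect]
    by_cases hG : a ∈ G
    · have := hfG a hG
      simp [hG, hGF hG, this]
    · by_cases hF : a ∈ F
      · simpa [hG, hF] using hfF a hF
      · simpa [hG, hF] using (f a).prob_nonneg O E
  rw [expect_add, expect_mul_left, expect_mul_left, ← prob_eq_expect, ← prob_eq_expect, hF1]
    at key
  have := mul_le_mul_of_nonneg_left hG (sub_nonneg.2 hs)
  linarith

/-- Union bound for two successive steps. -/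
theorem le_prob_bind (p : Prog R α) (f : α → Prog R β) {E : Set β} {F : Set α} {x y : ℝ}
    (hy : 0 ≤ y) (hF : 1 - x ≤ p.prob O F) (hf : ∀ a ∈ F, 1 - y ≤ (f a).prob O E) :
    1 - (x + y) ≤ (p.bind f).prob O E := by
  have key : p.expect O (fun a => F.indicator (fun _ => 1) a + -y) ≤ (p.bind f).prob O E := by
    rw [prob_eq_expect, expect_bind]
    refine p.expect_mono O fun a => ?_
    rw [← prob_eq_expect]
    by_cases h : a ∈ F
    · have := hf a h
      simp only [h, Set.indicator_of_mem]
      linarith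
    · have := (f a).prob_nonneg O E
      simp only [h, not_false_eq_true, Set.indicator_of_notMem]
      linarith
  rw [expect_add, expect_const, ← prob_eq_expect] at key
  linarith

/-- Union bound for a loop over a list, with an invariant that may depend on the part of the
list that is still to be processed. -/
theorem le_prob_foldlM {γ : Type} (step : β → γ → Prog R β) (J : List γ → β → Prop) {x : ℝ}
    (hx : 0 ≤ x)
    (hstep : ∀ a l b, J (a :: l) b → 1 - x ≤ (step b a).prob O {b' | J l b'})
    (l : List γ) (b : β) (hb : J l b) :
    1 - l.length * x ≤ (l.foldlM step b).prob O {b' | J [] b'} := by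
  induction l generalizing b with
  | nil =>
    rw [List.foldlM_nil]
    exact (le_of_eq (by simp)).trans (prob_done_of_mem O (by exact hb)).ge
  | cons a l ih =>
    rw [List.foldlM_cons]
    have := le_prob_bind O (step b a) (fun b' => l.foldlM step b')
      (mul_nonneg (Nat.cast_nonneg l.length) hx) (hstep a l b hb) ih
    refine le_trans (le_of_eq ?_) this
    push_cast [List.length_cons]
    ring

end Expectation

section Queries

variable {R α β : Type}

theorem queries_bind_le (p : Prog R α) (f : α → Prog R β) {n : ℕ}
    (hf : ∀ a, (f a).queries ≤ n) : (p.bind f).queries ≤ p.queries + n := by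
  induction p with
  | done a => simpa [bind, queries] using hf a
  | run W w₀ c k ih =>
    simp only [bind, queries, add_assoc]
    gcongr
    refine Finset.sup_le fun w hw => (ih w).trans ?_
    gcongr
    exact Finset.le_sup (f := fun w => (k w).queries) hw

theorem queries_foldlM_le {γ : Type} (step : β → γ → Prog R β) {n : ℕ}
    (hstep : ∀ b a, (step b a).queries ≤ n) (l : List γ) (b : β) :
    (l.foldlM step b).queries ≤ l.length * n := by
  induction l generalizing b with
  | nil =>
    rw [List.foldlM_nil]
    exact Nat.zero_le _
  | cons a l ih =>
    rw [List.foldlM_cons]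
    refine (queries_bind_le _ _ ih).trans ?_
    have := hstep b a
    rw [List.length_cons, Nat.succ_mul]
    omega

end Queries

end Prog

/-! ### Replacing an oracle by a circuit -/

section Substitution

variable {R Q Z : Type}

/-- The state `φ ⊗ |z₀⟩`. -/
def withAux {W Z : Type} [DecidableEq Z] (z₀ : Z) (φ : W → ℂ) : W × Z → ℂ :=
  fun w => if w.2 = z₀ then φ w.1 else 0

theorem withAux_single {W : Type} [DecidableEq W] [DecidableEq Z] (w₀ : W) (z₀ : Z) :
    withAux z₀ (Pi.single w₀ 1) = (Pi.single (w₀, z₀) 1 : W × Z → ℂ) := by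
  funext ⟨w, z⟩
  by_cases hz : z = z₀ <;> by_cases hw : w = w₀ <;> simp [withAux, hz, hw]

theorem Gate.cost_subst (B : Circuit R (Q × Z)) {W : Type} (g : Gate Q W) :
    Circuit.cost (g.subst B) = g.cost * B.cost := by
  cases g with
  | unitary e U => simp [Gate.subst, Circuit.cost, Gate.lift, Gate.cost]
  | perm σ => simp [Gate.subst, Circuit.cost, Gate.lift, Gate.cost]
  | query e => exact (Circuit.cost_lift _ B).trans (one_mul _).symm
  | queryInv e => exact ((Circuit.cost_lift _ B.inv).trans B.cost_inv).trans (one_mul _).symm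

theorem Circuit.cost_subst (B : Circuit R (Q × Z)) {W : Type} (c : Circuit Q W) :
    Circuit.cost (c.flatMap (Gate.subst B)) = c.cost * B.cost := by
  induction c with
  | nil => simp [Circuit.cost]
  | cons g c ih =>
    rw [List.flatMap_cons, Circuit.cost_append, ih, Gate.cost_subst, Circuit.cost_cons, add_mul]

theorem Prog.queries_subst_le [Fintype Z] [DecidableEq Z] (B : Circuit R (Q × Z)) (z₀ : Z)
    {α : Type} (p : Prog Q α) : (p.subst B z₀).queries ≤ p.queries * B.cost := by
  induction p with
  | done a => simp [Prog.subst, Prog.queries]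
  | run W w₀ c k ih =>
    simp only [Prog.subst, Prog.queries, Circuit.cost_subst, add_mul]
    gcongr
    refine Finset.sup_le fun w _ => (ih w.1).trans ?_
    gcongr
    exact Finset.le_sup (f := fun w => (k w).queries) (Finset.mem_univ w.1)

variable [Fintype R] [DecidableEq R] [Fintype Q] [DecidableEq Z]
  {O : Matrix.unitaryGroup R ℂ} {B : Circuit R (Q × Z)} {z₀ : Z}

theorem apply_lift_regs {C : Circuit R (Q × Z)} {M : Matrix Q Q ℂ}
    (hC : ∀ φ, C.apply O (withAux z₀ φ) = withAux z₀ (M.mulVec φ)) {W X : Type}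
    (e : W ≃ Q × X) (ψ : W → ℂ) :
    Circuit.apply O (C.map (Gate.lift (Gate.subst.regs e))) (withAux z₀ ψ) =
      withAux z₀ (applyOn e M ψ) := by
  funext w
  rw [Circuit.lift_apply]
  have h : (fun v => (withAux z₀ ψ : W × Z → ℂ) ((Gate.subst.regs e).symm
      (v, ((Gate.subst.regs e) w).2))) = withAux z₀ (fun q => ψ (e.symm (q, (e w.1).2))) := by
    funext v
    rfl
  rw [h, hC]
  rfl

variable [DecidableEq Q] {U : Matrix.unitaryGroup Q ℂ}

theorem apply_inv_withAux (hB : ∀ φ, B.apply O (withAux z₀ φ) = withAux z₀ (U.1.mulVec φ))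
    (φ : Q → ℂ) : B.inv.apply O (withAux z₀ φ) = withAux z₀ ((star U.1).mulVec φ) := by
  have h := hB ((star U.1).mulVec φ)
  rw [Matrix.mulVec_mulVec, Matrix.mem_unitaryGroup_iff.1 U.2, Matrix.one_mulVec] at h
  rw [← h, Circuit.inv_apply_apply]

theorem Gate.apply_subst (hB : ∀ φ, B.apply O (withAux z₀ φ) = withAux z₀ (U.1.mulVec φ))
    {W : Type} (g : Gate Q W) (ψ : W → ℂ) :
    Circuit.apply O (g.subst B) (withAux z₀ ψ) = withAux z₀ (g.apply U ψ) := by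
  cases g with
  | unitary e T =>
    funext w
    simp only [Gate.subst, Circuit.apply_cons, Circuit.apply_nil, Gate.lift_apply]
    by_cases hw : w.2 = z₀ <;> simp [withAux, hw, Gate.apply, applyOn]
  | perm σ =>
    funext w
    simp only [Gate.subst, Circuit.apply_cons, Circuit.apply_nil, Gate.lift_apply]
    by_cases hw : w.2 = z₀ <;> simp [withAux, hw, Gate.apply]
  | query e => exact apply_lift_regs hB e ψ
  | queryInv e => exact apply_lift_regs (apply_inv_withAux hB) e ψ

theorem Circuit.apply_subst (hB : ∀ φ, B.apply O (withAux z₀ φ) = withAux z₀ (U.1.mulVec φ))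
    {W : Type} (c : Circuit Q W) (ψ : W → ℂ) :
    Circuit.apply O (c.flatMap (Gate.subst B)) (withAux z₀ ψ) = withAux z₀ (c.apply U ψ) := by
  induction c generalizing ψ with
  | nil => rfl
  | cons g c ih =>
    rw [List.flatMap_cons, Circuit.apply_append, Gate.apply_subst hB, ih, Circuit.apply_cons]

/-- If the circuit `B` acts as the unitary `U` whenever its auxiliary register is in `|z₀⟩`, and
returns that register to `|z₀⟩`, then it can be substituted for the oracle `U`. -/
theorem Prog.prob_subst [Fintype Z]
    (hB : ∀ φ, B.apply O (withAux z₀ φ) = withAux z₀ (U.1.mulVec φ)) {α : Type}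
    (p : Prog Q α) (E : Set α) : (p.subst B z₀).prob O E = p.prob U E := by
  induction p with
  | done a => rfl
  | run W w₀ c k ih =>
    simp only [Prog.subst, Prog.prob]
    rw [Fintype.sum_prod_type]
    refine Finset.sum_congr rfl fun w _ => ?_
    have h : Circuit.apply O (c.flatMap (Gate.subst B)) (Pi.single (w₀, z₀) 1) =
        withAux z₀ (c.apply U (Pi.single w₀ 1)) := by
      rw [← withAux_single, Circuit.apply_subst hB]
    rw [Finset.sum_eq_single z₀]
    · rw [ih]
      congr 3
      exact (congrFun h (w, z₀)).trans (by simp [withAux])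
    · intro z _ hz
      have h0 : Circuit.apply O (c.flatMap (Gate.subst B)) (Pi.single (w₀, z₀) 1) (w, z) = 0 :=
        (congrFun h (w, z)).trans (by simp [withAux, hz])
      have h1 : ‖Circuit.apply O (c.flatMap (Gate.subst B)) (Pi.single (w₀, z₀) 1) (w, z)‖ ^ 2
          = 0 := by rw [h0]; simp
      refine mul_eq_zero_of_left ?_ _
      convert h1
    · simp

end Substitution

/-! ### Grover iterations -/

section Grover

variable {N : ℕ}

/-- The reflection `1 - c v vᵀ`, where `c = 2 / ‖v‖²` or `c = 0`. -/
noncomputable def reflection (c : ℝ) (v : Fin N → ℝ) (h : c * (c * ∑ i, v i ^ 2) = c * 2) :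
    Matrix.unitaryGroup (Fin N) ℂ :=
  ⟨((1 : Matrix (Fin N) (Fin N) ℝ) - c • Matrix.vecMulVec v v).map Complex.ofReal, by
    have hsymm : ((1 : Matrix (Fin N) (Fin N) ℝ) - c • Matrix.vecMulVec v v).transpose =
        1 - c • Matrix.vecMulVec v v := by
      simp [Matrix.transpose_vecMulVec]
    have hsq : ((1 : Matrix (Fin N) (Fin N) ℝ) - c • Matrix.vecMulVec v v) *
        (1 - c • Matrix.vecMulVec v v) = 1 := by
      have hv : Matrix.vecMulVec v v * Matrix.vecMulVec v v =
          (∑ i, v i ^ 2) • Matrix.vecMulVec v v := by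
        ext i j
        simp only [Matrix.mul_apply, Matrix.vecMulVec_apply, Matrix.smul_apply, smul_eq_mul,
          Finset.sum_mul]
        exact Finset.sum_congr rfl fun k _ => by ring
      rw [sub_mul, one_mul, mul_sub, mul_one, smul_mul_smul_comm, hv, smul_smul]
      have : c * c * ∑ i, v i ^ 2 = 2 * c := by linarith
      rw [this, two_mul, add_smul]
      abel
    rw [Matrix.mem_unitaryGroup_iff']
    have hstar : ∀ A : Matrix (Fin N) (Fin N) ℝ,
        star (A.map Complex.ofReal) = A.transpose.map Complex.ofReal := fun A => by
      ext i j
      simp [Matrix.star_apply]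
    rw [hstar, hsymm]
    have := congrArg (fun A : Matrix (Fin N) (Fin N) ℝ => A.map Complex.ofRealHom) hsq
    rw [Matrix.map_mul, Matrix.map_one _ (map_zero _) (map_one _)] at this
    exact this⟩

theorem reflection_mulVec (c : ℝ) (v : Fin N → ℝ) (h : c * (c * ∑ i, v i ^ 2) = c * 2)
    (a : Fin N → ℝ) (i : Fin N) :
    ∑ k, (reflection c v h).1 i k * (a k : ℂ) =
      ((a i - c * v i * ∑ k, v k * a k : ℝ) : ℂ) := by
  have h1 : ∀ k, (reflection c v h).1 i k * (a k : ℂ) =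
      (((if i = k then a k else 0) - c * v i * (v k * a k) : ℝ) : ℂ) := fun k => by
    simp only [reflection, Matrix.map_apply, Matrix.sub_apply, Matrix.one_apply,
      Matrix.smul_apply, Matrix.vecMulVec_apply, smul_eq_mul]
    rw [← Complex.ofReal_mul]
    congr 1
    split_ifs <;> ring
  simp only [h1]
  rw [← Complex.ofReal_sum, Finset.sum_sub_distrib, ← Finset.mul_sum, Finset.sum_ite_eq]
  simp

variable {q : ℕ}

/-- The sign `-1` on the words that are at most `v`. -/
noncomputable def phaseGate (v : Word q) : Matrix.unitaryGroup (Word q) ℂ :=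
  ⟨Matrix.diagonal fun w => if v < w then 1 else -1, by
    rw [Matrix.mem_unitaryGroup_iff', Matrix.star_eq_conjTranspose, Matrix.diagonal_conjTranspose,
      Matrix.diagonal_mul_diagonal, ← Matrix.diagonal_one]
    congr 1
    funext w
    by_cases h : v < w <;> simp [h]⟩

/-- The state `∑ᵢ aᵢ |i⟩|F i⟩`. -/
def embed (F : Fin N → Word q) (a : Fin N → ℝ) : Fin N × Word q → ℂ :=
  fun z => if z.2 = F z.1 then (a z.1 : ℂ) else 0

theorem embed_eq_sum (F : Fin N → Word q) (a : Fin N → ℝ) :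
    embed F a = ∑ i, (a i : ℂ) • (Pi.single (i, F i) 1 : Fin N × Word q → ℂ) := by
  funext ⟨k, w⟩
  rw [Finset.sum_apply, Finset.sum_eq_single k]
  · by_cases h : w = F k <;> simp [embed, h]
  · intro i _ hi
    simp [Ne.symm hi]
  · simp

/-- The number of indices whose entry exceeds `v`. -/
def rank (F : Fin N → Word q) (v : Word q) : ℕ := (Finset.univ.filter fun i => v < F i).card

variable {B : Matrix.unitaryGroup (Fin N × Word q) ℂ} {F : Fin N → Word q}

theorem query_embed (hB : ∀ i, B.1.mulVec (Pi.single (i, 0) 1) = Pi.single (i, F i) 1)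
    (a : Fin N → ℝ) :
    Gate.apply B (.query (Equiv.prodPUnit _).symm) (embed (fun _ => 0) a) = embed F a := by
  rw [embed_eq_sum, embed_eq_sum]
  change (Gate.toLin B (.query (Equiv.prodPUnit _).symm)) _ = _
  rw [map_sum]
  refine Finset.sum_congr rfl fun i _ => ?_
  rw [map_smul]
  congr 1
  exact applyOn_single _ (hB i) rfl

theorem queryInv_embed (hB : ∀ i, B.1.mulVec (Pi.single (i, 0) 1) = Pi.single (i, F i) 1)
    (a : Fin N → ℝ) :
    Gate.apply B (.queryInv (Equiv.prodPUnit _).symm) (embed F a) = embed (fun _ => 0) a := by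
  rw [← query_embed hB]
  exact Gate.inv_apply_apply B (.query (Equiv.prodPUnit _).symm) _

theorem phase_embed (v : Word q) (a : Fin N → ℝ) :
    Gate.apply B (.unitary (Equiv.prodComm _ _) (phaseGate v)) (embed F a) =
      embed F fun i => if v < F i then a i else -a i := by
  funext ⟨i, w⟩
  simp only [Gate.apply, applyOn, phaseGate, Matrix.diagonal_apply, Equiv.prodComm_apply,
    Equiv.prodComm_symm, Prod.swap, ite_mul, zero_mul, Finset.sum_ite_eq, Finset.mem_univ,
    if_true, embed]
  by_cases hw : w = F i
  · subst hw
    by_cases hv : v < F i <;> simp [hv]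
  · simp [hw]

theorem unitary_embed (U : Matrix.unitaryGroup (Fin N) ℂ) {a b : Fin N → ℝ}
    (h : ∀ i, ∑ k, U.1 i k * (a k : ℂ) = (b i : ℂ)) :
    Gate.apply B (.unitary (Equiv.refl _) U) (embed (fun _ => (0 : Word q)) a) =
      embed (fun _ => 0) b := by
  funext ⟨i, w⟩
  by_cases hw : w = 0 <;> simp [Gate.apply, applyOn, embed, hw, h]

variable [NeZero N]

/-- A unitary that maps `|0⟩` to the uniform superposition `∑ᵢ |i⟩ / √N`: the reflection that
exchanges these two unit vectors (the identity if `N = 1`, when the inverse below is `0`). -/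
noncomputable def uniformGate : Matrix.unitaryGroup (Fin N) ℂ :=
  reflection (1 - (√(N : ℝ))⁻¹)⁻¹ (fun i => (if i = 0 then 1 else 0) - (√(N : ℝ))⁻¹) (by
    have hN : (0 : ℝ) < N := Nat.cast_pos.2 (NeZero.pos N)
    have hs : (√(N : ℝ)) ^ 2 = N := Real.sq_sqrt hN.le
    have hs0 : √(N : ℝ) ≠ 0 := (Real.sqrt_pos.2 hN).ne'
    have hsum : ∑ i : Fin N, ((if i = 0 then 1 else 0) - (√(N : ℝ))⁻¹) ^ 2 =
        2 * (1 - (√(N : ℝ))⁻¹) := by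
      have : ∀ i : Fin N, ((if i = 0 then 1 else 0) - (√(N : ℝ))⁻¹) ^ 2 =
          (if i = 0 then 1 - 2 * (√(N : ℝ))⁻¹ else 0) + ((√(N : ℝ))⁻¹) ^ 2 := fun i => by
        split_ifs <;> ring
      simp only [this, Finset.sum_add_distrib, Finset.sum_ite_eq', Finset.mem_univ, if_true,
        Finset.sum_const, Finset.card_univ, Fintype.card_fin, nsmul_eq_mul]
      rw [inv_pow, hs, mul_inv_cancel₀ hN.ne']
      ring
    rw [hsum]
    by_cases h : 1 - (√(N : ℝ))⁻¹ = 0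
    · simp [h]
    · field_simp)

theorem uniformGate_apply (i : Fin N) :
    ∑ k, (uniformGate (N := N)).1 i k * (((if k = 0 then 1 else 0 : ℝ)) : ℂ) =
      (((√(N : ℝ))⁻¹ : ℝ) : ℂ) := by
  rw [uniformGate, reflection_mulVec]
  congr 1
  simp only [mul_ite, mul_one, mul_zero, Finset.sum_ite_eq', Finset.mem_univ, if_true]
  by_cases h : 1 - (√(N : ℝ))⁻¹ = 0
  · rw [h, inv_zero]
    have hN : (√(N : ℝ))⁻¹ = 1 := by linarith
    have hN1 : N = 1 := by
      have : √(N : ℝ) = 1 := inv_eq_one.1 hN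
      have h2 := Real.sq_sqrt (Nat.cast_nonneg (α := ℝ) N)
      rw [this] at h2
      exact_mod_cast (h2.symm.trans (one_pow 2))
    subst hN1
    rw [Subsingleton.elim i 0, hN]
    simp
  · rw [mul_right_comm, inv_mul_cancel₀ h]
    ring

/-- The inversion about the mean, up to a sign. -/
noncomputable def diffusionGate : Matrix.unitaryGroup (Fin N) ℂ :=
  reflection (2 / N) (fun _ => 1) (by
    have hN : (N : ℝ) ≠ 0 := Nat.cast_ne_zero.2 (NeZero.ne N)
    simp [hN])

variable (N) in
/-- One Grover iteration for the indices whose entry exceeds `v`. Both signs, of the phase gate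
and of the diffusion, are opposite to the usual ones. -/
noncomputable def groverIteration (v : Word q) : Circuit (Fin N × Word q) (Fin N × Word q) :=
  [.query (Equiv.prodPUnit _).symm, .unitary (Equiv.prodComm _ _) (phaseGate v),
    .queryInv (Equiv.prodPUnit _).symm, .unitary (Equiv.refl _) diffusionGate]

variable (N) in
/-- Grover search with `j` iterations for the indices whose entry exceeds `v`, followed by a
query that writes the entry at the index into the word register. -/
noncomputable def groverCircuit (v : Word q) (j : ℕ) :
    Circuit (Fin N × Word q) (Fin N × Word q) :=
  .unitary (Equiv.refl _) uniformGate ::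
    ((List.replicate j (groverIteration N v)).flatten ++ [.query (Equiv.prodPUnit _).symm])

theorem cost_groverCircuit (v : Word q) (j : ℕ) :
    (groverCircuit N v j).cost = 2 * j + 1 := by
  have h : Circuit.cost (List.replicate j (groverIteration N v)).flatten = 2 * j := by
    induction j with
    | zero => rfl
    | succ j ih =>
      rw [List.replicate_succ, List.flatten_cons, Circuit.cost_append, ih]
      have : (groverIteration N v).cost = 2 := rfl
      omega
  rw [groverCircuit, Circuit.cost_cons, Circuit.cost_append, h]
  change 0 + (2 * j + 1) = _
  omega

/-- The effect of a Grover iteration on the amplitudes. -/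
noncomputable def groverStep (F : Fin N → Word q) (v : Word q) (a : Fin N → ℝ) : Fin N → ℝ :=
  fun i => (if v < F i then a i else -a i) - 2 / N * ∑ k, if v < F k then a k else -a k

theorem groverIteration_embed
    (hB : ∀ i, B.1.mulVec (Pi.single (i, 0) 1) = Pi.single (i, F i) 1) (v : Word q)
    (a : Fin N → ℝ) :
    (groverIteration N v).apply B (embed (fun _ => 0) a) =
      embed (fun _ => 0) (groverStep F v a) := by
  simp only [groverIteration, Circuit.apply_cons, Circuit.apply_nil]
  rw [query_embed hB, phase_embed, queryInv_embed hB]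
  refine unitary_embed _ fun i => ?_
  rw [diffusionGate, reflection_mulVec]
  simp [groverStep]

theorem groverCircuit_apply
    (hB : ∀ i, B.1.mulVec (Pi.single (i, 0) 1) = Pi.single (i, F i) 1) (v : Word q) (j : ℕ) :
    (groverCircuit N v j).apply B (Pi.single (0, 0) 1) =
      embed F ((groverStep F v)^[j] fun _ => (√(N : ℝ))⁻¹) := by
  have h0 : (Pi.single (0, 0) 1 : Fin N × Word q → ℂ) =
      embed (fun _ => 0) fun k => if k = 0 then 1 else 0 := by
    funext ⟨i, w⟩
    by_cases hi : i = 0 <;> by_cases hw : w = 0 <;> simp [embed, hi, hw]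
  have hit : ∀ a : Fin N → ℝ, Circuit.apply B (List.replicate j (groverIteration N v)).flatten
      (embed (fun _ => 0) a) = embed (fun _ => 0) ((groverStep F v)^[j] a) := by
    induction j with
    | zero => exact fun a => rfl
    | succ j ih =>
      intro a
      rw [List.replicate_succ, List.flatten_cons, Circuit.apply_append,
        groverIteration_embed hB, ih, Function.iterate_succ_apply]
  rw [groverCircuit, Circuit.apply_cons, h0, unitary_embed _ uniformGate_apply,
    Circuit.apply_append, hit, Circuit.apply_cons, query_embed hB, Circuit.apply_nil]

/-- With `sin² θ = t / N`, where `t` is the number of marked indices, `j` Grover iterations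
rotate the state to the angle `(2j + 1) θ`. -/
theorem groverStep_iterate {v : Word q} (h0 : 0 < rank F v) (hN : rank F v < N) {θ : ℝ}
    (hsin : Real.sin θ = √(rank F v / N)) (hcos : Real.cos θ = √((N - rank F v) / N)) (j : ℕ)
    (i : Fin N) :
    (groverStep F v)^[j] (fun _ => (√(N : ℝ))⁻¹) i =
      if v < F i then Real.sin ((2 * j + 1) * θ) / √(rank F v)
      else Real.cos ((2 * j + 1) * θ) / √(N - rank F v) := by
  set t := rank F v with ht
  have hNpos : (0 : ℝ) < N := Nat.cast_pos.2 (NeZero.pos N)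
  have htpos : (0 : ℝ) < t := Nat.cast_pos.2 h0
  have hupos : (0 : ℝ) < N - t := sub_pos.2 (Nat.cast_lt.2 hN)
  have hn2 := Real.sq_sqrt hNpos.le
  have ht2 := Real.sq_sqrt htpos.le
  have hu2 := Real.sq_sqrt hupos.le
  have hn0 := Real.sqrt_pos.2 hNpos
  have ht0 := Real.sqrt_pos.2 htpos
  have hu0 := Real.sqrt_pos.2 hupos
  rw [Real.sqrt_div htpos.le] at hsin
  rw [Real.sqrt_div hupos.le] at hcos
  have hsum : ∀ α β : ℝ, (∑ k : Fin N, if v < F k then α else β) = t * α + (N - t) * β := by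
    intro α β
    rw [Finset.sum_ite, Finset.sum_const, Finset.sum_const, nsmul_eq_mul, nsmul_eq_mul]
    have hc := Finset.card_filter_add_card_filter_not (s := (Finset.univ : Finset (Fin N)))
      (fun k => v < F k)
    rw [Finset.card_univ, Fintype.card_fin] at hc
    have : ((Finset.univ.filter fun k => ¬ v < F k).card : ℝ) = N - t := by
      rw [ht, rank, eq_sub_iff_add_eq']
      exact_mod_cast hc
    rw [this]
    rfl
  induction j generalizing i with
  | zero =>
    simp only [Function.iterate_zero, id_eq, Nat.cast_zero, mul_zero, zero_add, one_mul]
    rw [hsin, hcos]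
    split_ifs <;> field_simp
  | succ j ih =>
    rw [Function.iterate_succ_apply']
    set φ := (2 * (j : ℝ) + 1) * θ with hφ
    have hangle : (2 * ((j + 1 : ℕ) : ℝ) + 1) * θ = φ + 2 * θ := by
      rw [hφ]
      push_cast
      ring
    have hite : ∀ k, (if v < F k then ((groverStep F v)^[j] fun _ => (√(N : ℝ))⁻¹) k
        else -((groverStep F v)^[j] fun _ => (√(N : ℝ))⁻¹) k) =
        if v < F k then Real.sin φ / √t else -(Real.cos φ / √(N - t)) := by
      intro k
      rw [ih k]
      split_ifs <;> rfl
    -- The mean of the amplitudes, after the phase gate, is `-cos (φ + θ) / √N`.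
    have hmean : 2 / (N : ℝ) * (t * (Real.sin φ / √t) + (N - t) * -(Real.cos φ / √(N - t))) =
        -(2 * Real.cos (φ + θ) / √N) := by
      rw [Real.cos_add, hsin, hcos]
      have e1 : (t : ℝ) * (Real.sin φ / √t) = √t * Real.sin φ := by
        nth_rw 1 [← ht2]
        field_simp
      have e2 : ((N : ℝ) - t) * -(Real.cos φ / √(N - t)) = -(√(N - t) * Real.cos φ) := by
        nth_rw 1 [← hu2]
        field_simp
      rw [e1, e2]
      nth_rw 1 [← hn2]
      field_simp
      ring
    rw [groverStep, hangle]
    simp only [hite]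
    rw [hsum, hmean]
    have h2 : φ + 2 * θ = (φ + θ) + θ := by ring
    have hφ1 : φ = (φ + θ) - θ := by ring
    split_ifs
    · rw [h2, Real.sin_add (φ + θ) θ]
      nth_rw 1 [hφ1]
      rw [Real.sin_sub (φ + θ) θ, hsin, hcos]
      field_simp
      ring
    · rw [h2, Real.cos_add (φ + θ) θ]
      nth_rw 1 [hφ1]
      rw [Real.cos_sub (φ + θ) θ, hsin, hcos]
      field_simp
      ring

end Grover

/-! ### Quantum maximum searching -/

section Estimates

variable {N q : ℕ}

/-- If the fraction `t / N` of marked indices lies between `1 / 4 ^ (i + 1)` and `1 / 4 ^ i`, then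
after `2 ^ i / 2` Grover iterations the angle is between `1 / 2` and `3 π / 4`. -/
theorem quarter_le_sin {t : ℝ} {n : ℝ} (ht : 0 < t) (hn : t < n) (i : ℕ) (h1 : t * 4 ^ i < n)
    (h2 : n ≤ t * 4 ^ (i + 1)) :
    1 / 4 ≤ Real.sin ((2 * ((2 ^ i / 2 : ℕ) : ℝ) + 1) * Real.arcsin √(t / n)) := by
  have hnpos : 0 < n := ht.trans hn
  set x := √(t / n) with hx
  have hx2 : x ^ 2 = t / n := Real.sq_sqrt (by positivity)
  have hx0 : 0 ≤ x := Real.sqrt_nonneg _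
  have hpow : (0 : ℝ) < 2 ^ i := by positivity
  have h4 : ((2 : ℝ) ^ i) ^ 2 = 4 ^ i := by rw [← pow_mul, mul_comm, pow_mul]; norm_num
  have hxu : x * 2 ^ i ≤ 1 := by
    refine le_of_sq_le_sq ?_ zero_le_one
    rw [mul_pow, hx2, h4, div_mul_eq_mul_div, one_pow, div_le_one hnpos]
    exact h1.le
  have hxl : 1 / 2 ≤ x * 2 ^ i := by
    refine le_of_sq_le_sq ?_ (by positivity)
    rw [mul_pow, hx2, h4, div_mul_eq_mul_div, le_div_iff₀ hnpos]
    rw [pow_succ] at h2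
    linarith
  have hx1 : x ≤ 1 := by
    have : (1 : ℝ) ≤ 2 ^ i := one_le_pow₀ (by norm_num)
    nlinarith
  set θ := Real.arcsin x with hθ
  have hsin : Real.sin θ = x := Real.sin_arcsin (by linarith) hx1
  have hθ0 : 0 ≤ θ := Real.arcsin_nonneg.2 hx0
  have hθ1 : θ ≤ Real.pi / 2 := Real.arcsin_le_pi_div_two x
  have hθl : x ≤ θ := hsin ▸ Real.sin_le hθ0
  have hθu : 2 / Real.pi * θ ≤ x := hsin ▸ Real.mul_le_sin hθ0 hθ1
  set m : ℝ := 2 * ((2 ^ i / 2 : ℕ) : ℝ) + 1 with hm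
  have hml : (2 : ℝ) ^ i ≤ m := by
    have : 2 ^ i ≤ 2 * (2 ^ i / 2) + 1 := by omega
    rw [hm]
    exact_mod_cast this
  have hmu : m ≤ 3 / 2 * 2 ^ i := by
    have : 2 * (2 * (2 ^ i / 2) + 1) ≤ 3 * 2 ^ i := by
      cases i with
      | zero => norm_num
      | succ i =>
        have : 1 ≤ 2 ^ i := Nat.one_le_two_pow
        rw [pow_succ]
        omega
    have : 2 * m ≤ 3 * 2 ^ i := by
      rw [hm]
      exact_mod_cast this
    linarith
  have hpi := Real.pi_pos
  have hpi4 := Real.pi_le_four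
  have hyl : 1 / 2 ≤ m * θ := by
    calc 1 / 2 ≤ x * 2 ^ i := hxl
      _ ≤ θ * m := by gcongr
      _ = m * θ := mul_comm _ _
  have hyu : m * θ ≤ 3 / 4 * Real.pi := by
    have h5 : θ ≤ Real.pi / 2 * x := by
      have := mul_le_mul_of_nonneg_left hθu (by positivity : 0 ≤ Real.pi / 2)
      have e : Real.pi / 2 * (2 / Real.pi * θ) = θ := by field_simp
      linarith
    calc m * θ ≤ 3 / 2 * 2 ^ i * (Real.pi / 2 * x) := by gcongr
      _ = 3 / 4 * Real.pi * (x * 2 ^ i) := by ring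
      _ ≤ 3 / 4 * Real.pi * 1 := by gcongr
      _ = 3 / 4 * Real.pi := mul_one _
  rcases le_total (m * θ) (Real.pi / 2) with h | h
  · have h6 := Real.mul_le_sin (by linarith) h
    have h7 : 1 / 4 ≤ 2 / Real.pi * (1 / 2) := by
      rw [div_mul_div_comm, div_le_div_iff₀ (by norm_num) (by positivity)]
      linarith
    have h8 : 2 / Real.pi * (1 / 2) ≤ 2 / Real.pi * (m * θ) := by gcongr
    linarith
  · have h6 := Real.mul_le_sin (x := Real.pi - m * θ) (by linarith) (by linarith)
    rw [Real.sin_pi_sub] at h6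
    have h7 : 2 / Real.pi * (Real.pi / 4) ≤ 2 / Real.pi * (Real.pi - m * θ) := by
      gcongr
      linarith
    have h8 : 2 / Real.pi * (Real.pi / 4) = 1 / 2 := by field_simp; norm_num
    linarith

theorem two_pow_clog_le (hN : 0 < N) : (2 : ℝ) ^ Nat.clog 4 N ≤ 2 * √(N : ℝ) := by
  have h1 : 4 ^ Nat.clog 4 N ≤ 4 * N := by
    by_cases h : N = 1
    · simp [h]
    · have h2 := Nat.pow_pred_clog_lt_self (b := 4) (by norm_num) (x := N) (by omega)
      have h3 : 0 < Nat.clog 4 N := Nat.clog_pos (by norm_num) (by omega)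
      obtain ⟨m, hm⟩ := Nat.exists_eq_succ_of_ne_zero h3.ne'
      rw [hm] at h2 ⊢
      rw [Nat.pow_succ]
      simp only [Nat.pred_succ] at h2
      omega
  have h2 : ((2 : ℝ) ^ Nat.clog 4 N) ^ 2 ≤ (2 * √(N : ℝ)) ^ 2 := by
    rw [mul_pow, Real.sq_sqrt (Nat.cast_nonneg N), ← pow_mul, mul_comm, pow_mul]
    norm_num
    exact_mod_cast h1
  exact le_of_sq_le_sq h2 (by positivity)

theorem rank_anti (F : Fin N → Word q) {v w : Word q} (h : v ≤ w) : rank F w ≤ rank F v :=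
  Finset.card_le_card fun i hi => by
    simp only [Finset.mem_filter, Finset.mem_univ, true_and] at hi ⊢
    exact h.trans_lt hi

theorem rank_lt (F : Fin N → Word q) (i : Fin N) : rank F (F i) < N := by
  have h : (Finset.univ.filter fun k => F i < F k) ⊂ Finset.univ :=
    Finset.filter_ssubset.2 ⟨i, Finset.mem_univ i, lt_irrefl _⟩
  simpa [rank] using Finset.card_lt_card h

/-- At least a quarter of the indices with an entry above `v` are such that fewer than a quarter
of these indices have a still larger entry. -/
theorem rank_le_four_mul_card (F : Fin N → Word q) (v : Word q) :
    rank F v ≤ 4 * (Finset.univ.filter fun i => v < F i ∧ 4 * rank F (F i) < rank F v).card := by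
  set G := Finset.univ.filter fun i => v < F i ∧ 4 * rank F (F i) < rank F v with hG
  set D := Finset.univ.filter fun i => v < F i ∧ ¬ 4 * rank F (F i) < rank F v with hD
  rcases D.eq_empty_or_nonempty with h | h
  · have : rank F v ≤ G.card := Finset.card_le_card fun i hi => by
      by_contra hn
      have : i ∈ D := by
        simp only [hG, hD, Finset.mem_filter, Finset.mem_univ, true_and] at hi hn ⊢
        tauto
      simp [h] at this
    omega
  · obtain ⟨i, hi, hmax⟩ := D.exists_max_image F h
    have hi' := (Finset.mem_filter.1 hi).2
    have : rank F (F i) ≤ G.card := Finset.card_le_card fun k hk => by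
      have hk' : F i < F k := (Finset.mem_filter.1 hk).2
      have hv : v < F k := hi'.1.trans hk'
      by_contra hn
      have : k ∈ D := by
        simp only [hG, hD, Finset.mem_filter, Finset.mem_univ, true_and] at hn ⊢
        tauto
      exact absurd (hmax k this) (not_le.2 hk')
    omega

theorem unfix_fix {p : ℕ} {x : ℝ} (h : Representable p q x) : unfix p (fix p q x) = x := by
  obtain ⟨w, rfl⟩ := h
  have h2 : (2 : ℝ) ^ p ≠ 0 := by positivity
  simp [unfix, fix, toWord, div_mul_cancel₀ _ h2]

end Estimates

section MaxSearch

variable {N : ℕ} [NeZero N] {q : ℕ}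

variable (N) in
/-- One run of Grover search; the result is an index together with its entry. -/
noncomputable def groverRun (v : Word q) (j : ℕ) :
    Prog (Fin N × Word q) (Fin N × Word q) :=
  .run (Fin N × Word q) (0, 0) (groverCircuit N v j) .done

/-- One attempt, with `j` Grover iterations, to find an entry larger than the best one so far.
The state of the search is an index together with its entry. -/
noncomputable def improve (j : ℕ) (st : Fin N × Word q) :
    Prog (Fin N × Word q) (Fin N × Word q) :=
  (groverRun N st.2 j).bind fun z => .done (if st.2 < z.2 then z else st)

/-- `R` attempts with `j` Grover iterations each. -/
noncomputable def improveRepeat (j : ℕ) :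
    ℕ → Fin N × Word q → Prog (Fin N × Word q) (Fin N × Word q)
  | 0, st => .done st
  | R + 1, st => (improve j st).bind (improveRepeat j R)

/-- The stages `i, …, i + k - 1` of the search. Stage `i` makes `2 ^ i / 2` Grover iterations per
attempt, and there are more attempts in the early, cheap stages. -/
noncomputable def searchStages (L : ℕ) :
    ℕ → ℕ → Fin N × Word q → Prog (Fin N × Word q) (Fin N × Word q)
  | 0, _, st => .done st
  | k + 1, i, st => (improveRepeat (2 ^ i / 2) (L * (k + 1)) st).bind (searchStages L k (i + 1))

/-- Maximum searching with failure probability `ζ`: start from a random index and run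
`⌈log₄ N⌉` stages, with the base number of attempts `L = ⌈64 log (2 / ζ)⌉`, so that
`(63 / 64) ^ L ≤ ζ / 2`. -/
noncomputable def maxSearch : MaxSearch := fun N _ q ζ =>
  ((groverRun N (0 : Word q) 0).bind
    (searchStages ⌈64 * Real.log (2 / ζ)⌉₊ (Nat.clog 4 N) 0)).bind fun st => .done st.1

/-! #### Number of queries -/

theorem queries_groverRun (v : Word q) (j : ℕ) : (groverRun N v j).queries = 2 * j + 1 := by
  simp [groverRun, Prog.queries, cost_groverCircuit]

theorem queries_improveRepeat_le (j R : ℕ) (st : Fin N × Word q) :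
    (improveRepeat j R st).queries ≤ R * (2 * j + 1) := by
  induction R generalizing st with
  | zero => exact Nat.zero_le _
  | succ R ih =>
    have h : (improve j st).queries ≤ 2 * j + 1 :=
      (Prog.queries_bind_le _ _ (n := 0) fun _ => le_rfl).trans (queries_groverRun _ _).le
    refine (Prog.queries_bind_le _ _ ih).trans ?_
    rw [Nat.succ_mul R, add_comm (R * _)]
    exact Nat.add_le_add_right h _

/-- The stages cost at most `4 L 2 ^ (i + k)` queries; the second summand on the left makes the
induction over the number `k` of stages work. -/
theorem queries_searchStages_le (L k i : ℕ) (st : Fin N × Word q) :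
    (searchStages L k i st).queries + L * 2 ^ i * (2 * k + 4) ≤ L * 2 ^ i * (4 * 2 ^ k) := by
  induction k generalizing i st with
  | zero => simp [searchStages, Prog.queries]
  | succ k ih =>
    have h1 : (searchStages L (k + 1) i st).queries ≤ L * (k + 1) * (2 * (2 ^ i / 2) + 1) +
        (L * 2 ^ (i + 1) * (4 * 2 ^ k) - L * 2 ^ (i + 1) * (2 * k + 4)) := by
      refine (Prog.queries_bind_le _ _ fun st' => Nat.le_sub_of_add_le (ih (i + 1) st')).trans ?_
      gcongr
      exact queries_improveRepeat_le _ _ _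
    have h2 : L * (k + 1) * (2 * (2 ^ i / 2) + 1) ≤ L * (k + 1) * (2 * 2 ^ i) := by
      gcongr
      have : 1 ≤ 2 ^ i := Nat.one_le_two_pow
      omega
    have h3 : L * 2 ^ (i + 1) * (2 * k + 4) ≤ L * 2 ^ (i + 1) * (4 * 2 ^ k) :=
      le_of_add_le_right (ih (i + 1) st)
    have h4 : L * (k + 1) * (2 * 2 ^ i) + L * 2 ^ i * (2 * (k + 1) + 4) =
        L * 2 ^ (i + 1) * (2 * k + 4) := by ring
    have h5 : L * 2 ^ i * (4 * 2 ^ (k + 1)) = L * 2 ^ (i + 1) * (4 * 2 ^ k) := by ring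
    omega

theorem queries_maxSearch_le {ζ : ℝ} (h0 : 0 < ζ) :
    ((maxSearch N q ζ).queries : ℝ) ≤ 1033 * √(N : ℝ) * max 1 (Real.log (1 / ζ)) := by
  set L := ⌈64 * Real.log (2 / ζ)⌉₊ with hL
  have h1 : (maxSearch N q ζ).queries ≤ 1 + L * (4 * 2 ^ Nat.clog 4 N) := by
    refine (Prog.queries_bind_le _ _ (n := 0) fun _ => le_rfl).trans ?_
    refine (Prog.queries_bind_le _ _ (n := L * (4 * 2 ^ Nat.clog 4 N)) fun st => ?_).trans ?_
    · have := queries_searchStages_le L (Nat.clog 4 N) 0 st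
      rw [pow_zero, mul_one] at this
      exact le_of_add_le_left this
    · rw [queries_groverRun]
  set m := max 1 (Real.log (1 / ζ)) with hm
  have hm1 : 1 ≤ m := le_max_left _ _
  have hm2 : Real.log (1 / ζ) ≤ m := le_max_right _ _
  have hLle : (L : ℝ) ≤ 129 * m := by
    have hlog : Real.log (2 / ζ) = Real.log 2 + Real.log (1 / ζ) := by
      rw [← Real.log_mul (by norm_num) (by positivity)]
      congr 1
      ring
    have h2 := Real.log_two_lt_d9
    by_cases hpos : 0 ≤ 64 * Real.log (2 / ζ)
    · have := (Nat.ceil_lt_add_one hpos).le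
      rw [← hL, hlog] at this
      linarith
    · rw [hL, Nat.ceil_eq_zero.2 (not_le.1 hpos).le]
      simp only [Nat.cast_zero]
      linarith
  have hN : (1 : ℝ) ≤ √(N : ℝ) := Real.one_le_sqrt.2 (Nat.one_le_cast.2 (NeZero.pos N))
  have hpow := two_pow_clog_le (NeZero.pos N)
  calc ((maxSearch N q ζ).queries : ℝ) ≤ 1 + L * (4 * 2 ^ Nat.clog 4 N) := by exact_mod_cast h1
    _ ≤ √(N : ℝ) * m + 129 * m * (4 * (2 * √(N : ℝ))) := by
        gcongr
        exact one_le_mul_of_one_le_of_one_le hN hm1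
    _ = 1033 * √(N : ℝ) * m := by ring

/-! #### Success probability -/

variable {B : Matrix.unitaryGroup (Fin N × Word q) ℂ} {F : Fin N → Word q}

/-- The states of the search in which the word is the entry at the index and fewer than
`N / 4 ^ i` entries are larger. -/
def goodStates (F : Fin N → Word q) (i : ℕ) : Set (Fin N × Word q) :=
  {st | st.2 = F st.1 ∧ rank F st.2 * 4 ^ i < N}

theorem prob_groverRun (hB : ∀ i, B.1.mulVec (Pi.single (i, 0) 1) = Pi.single (i, F i) 1)
    (v : Word q) (j : ℕ) (E : Set (Fin N × Word q)) :
    (groverRun N v j).prob B E =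
      ∑ i, ((groverStep F v)^[j] (fun _ => (√(N : ℝ))⁻¹) i) ^ 2 *
        E.indicator (fun _ => 1) (i, F i) := by
  simp only [groverRun, Prog.prob, groverCircuit_apply hB]
  rw [Fintype.sum_prod_type]
  refine Finset.sum_congr rfl fun i _ => ?_
  rw [Finset.sum_eq_single (F i)]
  · simp [embed]
  · intro w _ hw
    simp [embed, hw]
  · simp

theorem prob_groverRun_eq_one
    (hB : ∀ i, B.1.mulVec (Pi.single (i, 0) 1) = Pi.single (i, F i) 1) (v : Word q) (j : ℕ) :
    (groverRun N v j).prob B {z | z.2 = F z.1} = 1 := by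
  have h := (groverRun N v j).expect_const B 1
  have h1 : (groverRun N v j).prob B Set.univ = 1 := by
    rw [Prog.prob_eq_expect, Set.indicator_univ]
    exact h
  rw [← h1, prob_groverRun hB, prob_groverRun hB]
  simp

theorem prob_improve (j : ℕ) (st : Fin N × Word q) (E : Set (Fin N × Word q)) :
    (improve j st).prob B E =
      (groverRun N st.2 j).prob B {z | (if st.2 < z.2 then z else st) ∈ E} := by
  rw [improve, Prog.prob_eq_expect, Prog.expect_bind, Prog.prob_eq_expect]
  rfl

/-- An attempt never makes the state of the search worse. -/
theorem one_le_prob_improve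
    (hB : ∀ i, B.1.mulVec (Pi.single (i, 0) 1) = Pi.single (i, F i) 1) (j i : ℕ)
    {st : Fin N × Word q} (hst : st ∈ goodStates F i) :
    1 ≤ (improve j st).prob B (goodStates F i) := by
  rw [prob_improve, ← prob_groverRun_eq_one hB st.2 j]
  refine Prog.prob_mono _ _ fun z hz => ?_
  change (if st.2 < z.2 then z else st) ∈ goodStates F i
  split_ifs with h
  · exact ⟨hz, (Nat.mul_le_mul_right _ (rank_anti F h.le)).trans_lt hst.2⟩
  · exact hst

/-- In stage `i` an attempt succeeds with probability at least `1 / 64`: it finds a marked index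
with probability at least `1 / 16`, and that index is uniformly distributed. -/
theorem le_prob_improve
    (hB : ∀ i, B.1.mulVec (Pi.single (i, 0) 1) = Pi.single (i, F i) 1) (i : ℕ)
    {st : Fin N × Word q} (hst : st ∈ goodStates F i) :
    1 / 64 ≤ (improve (2 ^ i / 2) st).prob B (goodStates F (i + 1)) := by
  by_cases hgood : st ∈ goodStates F (i + 1)
  · exact le_trans (by norm_num) (one_le_prob_improve hB _ _ hgood)
  set v := st.2 with hv
  set t := rank F v with ht
  have hle : N ≤ t * 4 ^ (i + 1) := by
    by_contra h
    exact hgood ⟨hst.1, not_le.1 h⟩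
  have ht0 : 0 < t := by
    have := NeZero.pos N
    by_contra h
    rw [Nat.eq_zero_of_not_pos h] at hle
    omega
  have htN : t < N := by
    rw [ht, hv, hst.1]
    exact rank_lt F _
  have htpos : (0 : ℝ) < t := Nat.cast_pos.2 ht0
  have htN' : (t : ℝ) < N := Nat.cast_lt.2 htN
  have hNpos : (0 : ℝ) < N := htpos.trans htN'
  set θ := Real.arcsin √(t / N) with hθ
  have hx1 : √((t : ℝ) / N) ≤ 1 := Real.sqrt_le_one.2 ((div_le_one hNpos).2 htN'.le)
  have hsin : Real.sin θ = √(t / N) :=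
    Real.sin_arcsin (by linarith [Real.sqrt_nonneg ((t : ℝ) / N)]) hx1
  have hcos : Real.cos θ = √((N - t) / N) := by
    rw [hθ, Real.cos_arcsin, Real.sq_sqrt (by positivity)]
    congr 1
    field_simp
  have hquarter := quarter_le_sin htpos htN' i (by exact_mod_cast hst.2) (by exact_mod_cast hle)
  set s := Real.sin ((2 * ((2 ^ i / 2 : ℕ) : ℝ) + 1) * θ) with hs
  have hs2 : 1 / 16 ≤ s ^ 2 := by nlinarith
  set G := Finset.univ.filter fun k => v < F k ∧ 4 * rank F (F k) < t with hG
  have hcard : (t : ℝ) ≤ 4 * G.card := by exact_mod_cast rank_le_four_mul_card F v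
  rw [prob_improve, prob_groverRun hB]
  have hmem : ∀ k ∈ G, ((groverStep F v)^[2 ^ i / 2] (fun _ => (√(N : ℝ))⁻¹) k) ^ 2 *
      Set.indicator {z : Fin N × Word q | (if st.2 < z.2 then z else st) ∈ goodStates F (i + 1)}
        (fun _ => (1 : ℝ)) (k, F k) = s ^ 2 / t := by
    intro k hk
    obtain ⟨hk1, hk2⟩ := (Finset.mem_filter.1 hk).2
    rw [Set.indicator_of_mem, groverStep_iterate ht0 htN hsin hcos, if_pos hk1, ← hs, div_pow,
      Real.sq_sqrt htpos.le, mul_one]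
    change (if v < F k then (k, F k) else st) ∈ goodStates F (i + 1)
    rw [if_pos hk1]
    refine ⟨rfl, ?_⟩
    have h1 : rank F v * 4 ^ i < N := hst.2
    have h2 : 4 * rank F (F k) * 4 ^ i ≤ t * 4 ^ i := Nat.mul_le_mul_right _ hk2.le
    calc rank F (F k) * 4 ^ (i + 1) = 4 * rank F (F k) * 4 ^ i := by ring
      _ < N := h2.trans_lt h1
  calc (1 : ℝ) / 64 ≤ G.card * (s ^ 2 / t) := by
        rw [mul_div_assoc', le_div_iff₀ htpos]
        nlinarith
    _ = ∑ k ∈ G, _ := by rw [Finset.sum_congr rfl hmem, Finset.sum_const, nsmul_eq_mul]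
    _ ≤ _ := Finset.sum_le_sum_of_subset_of_nonneg (Finset.subset_univ _) fun k _ _ =>
        mul_nonneg (sq_nonneg _) (Set.indicator_nonneg (fun _ _ => zero_le_one) _)

theorem one_le_prob_improveRepeat
    (hB : ∀ i, B.1.mulVec (Pi.single (i, 0) 1) = Pi.single (i, F i) 1) (j i R : ℕ)
    {st : Fin N × Word q} (hst : st ∈ goodStates F i) :
    1 ≤ (improveRepeat j R st).prob B (goodStates F i) := by
  induction R generalizing st with
  | zero => exact (Prog.prob_done_of_mem B hst).ge
  | succ R ih =>
    have := Prog.le_prob_bind B (improve j st) (improveRepeat j R) (x := 0) (y := 0) le_rfl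
      (by simpa using one_le_prob_improve hB j i hst) (fun st' h => by simpa using ih h)
    simpa [improveRepeat] using this

theorem le_prob_improveRepeat
    (hB : ∀ i, B.1.mulVec (Pi.single (i, 0) 1) = Pi.single (i, F i) 1) (i R : ℕ)
    {st : Fin N × Word q} (hst : st ∈ goodStates F i) :
    1 - (63 / 64) ^ R ≤ (improveRepeat (2 ^ i / 2) R st).prob B (goodStates F (i + 1)) := by
  induction R generalizing st with
  | zero => simpa using Prog.prob_nonneg B _ _
  | succ R ih =>
    have hsub : goodStates F (i + 1) ⊆ goodStates F i := fun z hz =>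
      ⟨hz.1, (Nat.mul_le_mul_left _ (Nat.pow_le_pow_right (by norm_num) i.le_succ)).trans_lt hz.2⟩
    have := Prog.le_prob_bind_of_subset B (improve (2 ^ i / 2) st) (improveRepeat (2 ^ i / 2) R)
      hsub (s := 1 - (63 / 64) ^ R)
      (sub_le_self _ (by positivity)) (one_le_prob_improve hB _ i hst)
      (le_prob_improve hB i hst) (fun _ h => ih h)
      (fun _ h => one_le_prob_improveRepeat hB _ (i + 1) R h)
    refine le_trans (le_of_eq ?_) this
    rw [pow_succ]
    ring

/-- The failure probabilities `x ^ k, …, x` of the `k` remaining stages, where `x = (63 / 64) ^ L`,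
sum up to at most `2 x - 2 x ^ (k + 1)`. -/
theorem le_prob_searchStages
    (hB : ∀ i, B.1.mulVec (Pi.single (i, 0) 1) = Pi.single (i, F i) 1) {L : ℕ}
    (hL : (63 / 64 : ℝ) ^ L ≤ 1 / 2) (k i : ℕ) {st : Fin N × Word q} (hst : st ∈ goodStates F i) :
    1 - (2 * (63 / 64) ^ L - 2 * ((63 / 64) ^ L) ^ (k + 1)) ≤
      (searchStages L k i st).prob B (goodStates F (i + k)) := by
  induction k generalizing i st with
  | zero => simpa [searchStages] using (Prog.prob_done_of_mem B hst).ge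
  | succ k ih =>
    set x : ℝ := (63 / 64) ^ L with hx
    have hx0 : 0 ≤ x := by positivity
    have hmono : x ^ (k + 1) ≤ x := pow_le_of_le_one hx0 (by linarith) (by omega)
    have := Prog.le_prob_bind B (improveRepeat (2 ^ i / 2) (L * (k + 1)) st)
      (searchStages L k (i + 1)) (E := goodStates F (i + 1 + k))
      (x := x ^ (k + 1)) (y := 2 * x - 2 * x ^ (k + 1)) (by linarith)
      (by rw [hx, ← pow_mul]; exact le_prob_improveRepeat hB i _ hst) (fun _ h => ih (i + 1) h)
    rw [show i + (k + 1) = i + 1 + k by omega]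
    refine le_trans ?_ this
    have h1 : x ^ (k + 1 + 1) ≤ x ^ (k + 1) * (1 / 2) := by
      rw [pow_succ]
      gcongr
    linarith

theorem le_prob_maxSearch
    (hB : ∀ i, B.1.mulVec (Pi.single (i, 0) 1) = Pi.single (i, F i) 1) {ζ : ℝ} (h0 : 0 < ζ)
    (h1 : ζ < 1) : 1 - ζ ≤ (maxSearch N q ζ).prob B {i | ∀ j, F j ≤ F i} := by
  set L := ⌈64 * Real.log (2 / ζ)⌉₊ with hL
  have hx : (63 / 64 : ℝ) ^ L ≤ ζ / 2 := by
    have hlog : Real.log (2 / ζ) ≤ L / 64 := by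
      have := Nat.le_ceil (64 * Real.log (2 / ζ))
      rw [← hL] at this
      linarith
    have hexp : (63 / 64 : ℝ) ≤ Real.exp (-(1 / 64)) := by
      have := Real.add_one_le_exp (-(1 / 64) : ℝ)
      linarith
    calc (63 / 64 : ℝ) ^ L ≤ Real.exp (-(1 / 64)) ^ L := by gcongr
      _ = Real.exp (-(L / 64)) := by
        rw [← Real.exp_nat_mul]
        congr 1
        ring
      _ ≤ Real.exp (-Real.log (2 / ζ)) := Real.exp_le_exp.2 (neg_le_neg hlog)
      _ = ζ / 2 := by rw [Real.exp_neg, Real.exp_log (by positivity), inv_div]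
  have hpow : N ≤ 4 ^ Nat.clog 4 N := Nat.le_pow_clog (by norm_num) N
  have hstart : {z : Fin N × Word q | z.2 = F z.1} ⊆ goodStates F 0 := fun z hz => by
    refine ⟨hz, ?_⟩
    rw [show z.2 = F z.1 from hz, pow_zero, mul_one]
    exact rank_lt F _
  have hsearch := Prog.le_prob_bind B (groverRun N (0 : Word q) 0)
    (searchStages L (Nat.clog 4 N) 0) (E := goodStates F (0 + Nat.clog 4 N)) (x := 0) (y := ζ)
    h0.le (by rw [sub_zero, prob_groverRun_eq_one hB]) (fun st hst => by
      refine le_trans ?_ (le_prob_searchStages hB (hx.trans (by linarith)) _ 0 (hstart hst))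
      have : (0 : ℝ) ≤ ((63 / 64) ^ L) ^ (Nat.clog 4 N + 1) := by positivity
      linarith)
  have hfinal : (maxSearch N q ζ).prob B {i | ∀ j, F j ≤ F i} =
      ((groverRun N (0 : Word q) 0).bind (searchStages L (Nat.clog 4 N) 0)).prob B
        {st | ∀ j, F j ≤ F st.1} := by
    rw [maxSearch, Prog.prob_eq_expect, Prog.expect_bind, Prog.prob_eq_expect]
    rfl
  rw [hfinal]
  rw [zero_add] at hsearch
  refine hsearch.trans (Prog.prob_mono _ _ fun st hst j => ?_)
  -- No entry is larger, because their number is less than `N / 4 ^ ⌈log₄ N⌉ ≤ 1`.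
  by_contra hlt
  have hpos : 0 < rank F st.2 := Finset.card_pos.2 ⟨j, by
    rw [Finset.mem_filter, hst.1]
    exact ⟨Finset.mem_univ j, not_le.1 hlt⟩⟩
  have h2 := hst.2
  rw [zero_add] at h2
  have h3 : 4 ^ Nat.clog 4 N ≤ rank F st.2 * 4 ^ Nat.clog 4 N := Nat.le_mul_of_pos_left _ hpos
  omega

theorem isQMS_maxSearch : IsQMS maxSearch 1033 := by
  refine ⟨by norm_num, fun N _ q ζ h0 h1 => ⟨queries_maxSearch_le h0, fun p f hf B hB => ?_⟩⟩
  refine (le_prob_maxSearch hB h0 h1).trans (Prog.prob_mono _ _ fun i hi j => ?_)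
  rw [← unfix_fix (hf i), ← unfix_fix (hf j)]
  unfold unfix
  gcongr
  exact hi j

end MaxSearch

/-! ### Backward induction -/

namespace MDP

section Bellman

variable {S A H : ℕ} (M : MDP S A H)

/-- `r_h(s,a) + ∑ₓ P_{h|s,a}(x) V(x)`. -/
def qval (V : Fin S → ℝ) (h : Fin H) (s : Fin S) (a : Fin A) : ℝ :=
  M.r h s a + ∑ x, M.P h s a x * V x

/-- First-step decomposition of the law of the state (which is defined by its last step). -/
theorem stateLaw_succ (π : Policy S A H) {h : ℕ} (hh : h < H) (s : Fin S) (k : ℕ) (x : Fin S) :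
    M.stateLaw π h s (k + 1) x =
      ∑ y, M.P ⟨h, hh⟩ s (π s ⟨h, hh⟩) y * M.stateLaw π (h + 1) y k x := by
  induction k generalizing x with
  | zero => simp [stateLaw, hh]
  | succ k ih =>
    have hT : ∀ n m : ℕ, n = m → ∀ z,
        (if hn : n < H then M.P ⟨n, hn⟩ z (π z ⟨n, hn⟩) x else 0) =
        if hm : m < H then M.P ⟨m, hm⟩ z (π z ⟨m, hm⟩) x else 0 := by
      rintro n _ rfl z
      rfl
    rw [stateLaw]
    simp only [ih, hT (h + (k + 1)) (h + 1 + k) (by omega)]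
    simp only [stateLaw, Finset.sum_mul, Finset.mul_sum, mul_assoc]
    exact Finset.sum_comm

theorem value_of_le (π : Policy S A H) {h : ℕ} (hh : H ≤ h) (s : Fin S) :
    M.value π h s = 0 :=
  Finset.sum_eq_zero fun t _ => if_neg (by omega)

/-- The Bellman equation of a policy. -/
theorem value_eq_qval (π : Policy S A H) (h : Fin H) (s : Fin S) :
    M.value π h s = M.qval (M.value π (h + 1)) h s (π s h) := by
  have key : ∀ t : Fin H,
      (if (h : ℕ) ≤ t then ∑ x, M.stateLaw π h s ((t : ℕ) - h) x * M.r t x (π x t) else 0) =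
      (if t = h then M.r h s (π s h) else 0) + ∑ y, M.P h s (π s h) y *
        if (h : ℕ) + 1 ≤ t then
          ∑ x, M.stateLaw π (h + 1) y ((t : ℕ) - (h + 1)) x * M.r t x (π x t) else 0 := by
    intro t
    rcases lt_trichotomy (t : ℕ) h with hlt | heq | hgt
    · have h1 : t ≠ h := fun e => by rw [e] at hlt; omega
      rw [if_neg (by omega), if_neg h1]
      simp [show ¬ (h : ℕ) + 1 ≤ t by omega]
    · have h1 : t = h := Fin.ext heq
      subst h1
      simp [stateLaw]
    · have h1 : t ≠ h := fun e => by rw [e] at hgt; omega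
      rw [if_pos (by omega), if_neg h1, zero_add,
        show (t : ℕ) - h = (t : ℕ) - (h + 1) + 1 by omega]
      simp only [M.stateLaw_succ π h.2, show (h : ℕ) + 1 ≤ t from hgt, if_true, Finset.sum_mul,
        Finset.mul_sum, Fin.eta, mul_assoc]
      exact Finset.sum_comm
  rw [value, Finset.sum_congr rfl fun t _ => key t, Finset.sum_add_distrib,
    Finset.sum_ite_eq' Finset.univ h, if_pos (Finset.mem_univ h), Finset.sum_comm, qval]
  simp only [value, Finset.mul_sum]

theorem backward_induction {p : ℕ → Prop} (hend : ∀ h, H ≤ h → p h)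
    (hstep : ∀ h : Fin H, p (h + 1) → p h) (h : ℕ) : p h := by
  obtain ⟨k, hk⟩ : ∃ k, H ≤ h + k := ⟨H, by omega⟩
  induction k generalizing h with
  | zero => exact hend h hk
  | succ k ih =>
    by_cases hh : h < H
    · exact hstep ⟨h, hh⟩ (ih (h + 1) (by omega))
    · exact hend h (by omega)

theorem qval_mono {V W : Fin S → ℝ} (hVW : ∀ s, V s ≤ W s) (h : Fin H) (s : Fin S) (a : Fin A) :
    M.qval V h s a ≤ M.qval W h s a := by
  unfold qval
  gcongr with x
  · exact M.P_nonneg h s a x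
  · exact hVW x

theorem qval_le {V : Fin S → ℝ} {b : ℝ} (hV : ∀ s, V s ≤ b) (h : Fin H) (s : Fin S)
    (a : Fin A) : M.qval V h s a ≤ b + 1 := by
  refine (M.qval_mono hV h s a).trans ?_
  rw [qval, ← Finset.sum_mul, M.P_sum, one_mul, add_comm]
  exact add_le_add_right (M.r_mem h s a).2 b

theorem value_le (π : Policy S A H) (h : ℕ) : ∀ s, M.value π h s ≤ ((H - h : ℕ) : ℝ) := by
  induction h using backward_induction (H := H) with
  | hend h hh => exact fun s => (M.value_of_le π hh s).trans_le (Nat.cast_nonneg _)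
  | hstep h ih =>
    intro s
    rw [M.value_eq_qval π h s]
    refine (M.qval_le ih h s _).trans (le_of_eq ?_)
    rw [show H - (h : ℕ) = H - (h + 1) + 1 by omega]
    push_cast
    ring

theorem value_congr {π π' : Policy S A H} (h : ℕ) :
    (∀ s (t : Fin H), h ≤ t → π s t = π' s t) → M.value π h = M.value π' h := by
  induction h using backward_induction (H := H) with
  | hend h hh =>
    intro _
    funext s
    rw [M.value_of_le π hh, M.value_of_le π' hh]
  | hstep h ih =>
    intro heq
    funext s
    rw [M.value_eq_qval π, M.value_eq_qval π', heq s h le_rfl,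
      ih fun s t ht => heq s t (by omega)]

/-- From time `h` on, no single deviation from `π` is profitable. -/
def GreedyFrom (π : Policy S A H) (h : ℕ) : Prop :=
  ∀ t : Fin H, h ≤ t → ∀ s a, M.qval (M.value π (t + 1)) t s a ≤ M.value π t s

variable {M}

theorem GreedyFrom.value_le {π : Policy S A H} {h : ℕ} (π' : Policy S A H) :
    M.GreedyFrom π h → ∀ s, M.value π' h s ≤ M.value π h s := by
  induction h using backward_induction (H := H) with
  | hend h hh =>
    intro _ s
    rw [M.value_of_le π hh, M.value_of_le π' hh]
  | hstep h ih =>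
    intro hg s
    rw [M.value_eq_qval π']
    exact (M.qval_mono (ih fun t ht => hg t (by omega)) h s _).trans (hg h le_rfl s _)

theorem GreedyFrom.optValue_eq {π : Policy S A H} {h : ℕ} (hg : M.GreedyFrom π h) (s : Fin S) :
    M.optValue h s = M.value π h s :=
  have : Nonempty (Policy S A H) := ⟨π⟩
  le_antisymm (ciSup_le fun π' => hg.value_le π' s)
    (le_ciSup (f := fun π' => M.value π' h s) (Set.finite_range _).bddAbove π)

end Bellman

/-! #### The invariants of backward induction -/

section Invariants

variable {S A H : ℕ} (M : MDP S A H) {β : Type} (enc : ℝ → β)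

/-- The state of backward induction before time `h` is processed further: a policy that is greedy
from time `h` on, and its values at time `h`, encoded by `enc`. -/
def SolvedFrom (h : ℕ) (st : Policy S A H × (Fin S → β)) : Prop :=
  (∀ s, st.2 s = enc (M.value st.1 h s)) ∧ M.GreedyFrom st.1 h

/-- The state of time step `h` of backward induction, started with the policy `π`, when the states
in the list `l` are still to be processed. -/
def StepInvariant (π : Policy S A H) (h : Fin H) (l : List (Fin S))
    (acc : Policy S A H × (Fin S → β)) : Prop :=
  (∀ s t, t ≠ h → acc.1 s t = π s t) ∧ ∀ s, s ∉ l →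
    (∀ a, M.qval (M.value π (h + 1)) h s a ≤ M.qval (M.value π (h + 1)) h s (acc.1 s h)) ∧
      acc.2 s = enc (M.qval (M.value π (h + 1)) h s (acc.1 s h))

variable {M enc}

theorem stepInvariant_finRange (h : Fin H) (st : Policy S A H × (Fin S → β)) :
    M.StepInvariant enc st.1 h (List.finRange S) st :=
  ⟨fun _ _ _ => rfl, fun s hs => absurd (List.mem_finRange s) hs⟩

theorem StepInvariant.update {π : Policy S A H} {h : Fin H} {s : Fin S} {l : List (Fin S)}
    {acc : Policy S A H × (Fin S → β)} (hacc : M.StepInvariant enc π h (s :: l) acc) {a : Fin A}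
    (ha : ∀ b, M.qval (M.value π (h + 1)) h s b ≤ M.qval (M.value π (h + 1)) h s a) :
    M.StepInvariant enc π h l (Function.update acc.1 s (Function.update (acc.1 s) h a),
      Function.update acc.2 s (enc (M.qval (M.value π (h + 1)) h s a))) := by
  refine ⟨fun s' t ht => ?_, fun s' hs' => ?_⟩
  · by_cases h1 : s' = s
    · subst h1
      simpa [ht] using hacc.1 s' t ht
    · simpa [h1] using hacc.1 s' t ht
  · by_cases h1 : s' = s
    · subst h1
      simpa using ha
    · simpa [h1] using hacc.2 s' (by simp [h1, hs'])

theorem StepInvariant.solvedFrom {h : Fin H} {st acc : Policy S A H × (Fin S → β)}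
    (hacc : M.StepInvariant enc st.1 h [] acc) (hst : M.SolvedFrom enc (h + 1) st) :
    M.SolvedFrom enc h acc := by
  have hlater : ∀ t : Fin H, (h : ℕ) + 1 ≤ t → t ≠ h := by
    rintro t ht rfl
    omega
  have hvalue : ∀ t : ℕ, (h : ℕ) + 1 ≤ t → M.value acc.1 t = M.value st.1 t := fun t ht =>
    M.value_congr t fun s t' ht' => hacc.1 s t' (hlater t' (ht.trans ht'))
  have hq : ∀ s, M.value acc.1 h s = M.qval (M.value st.1 (h + 1)) h s (acc.1 s h) := fun s => by
    rw [M.value_eq_qval, hvalue _ le_rfl]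
  refine ⟨fun s => ?_, fun t ht s a => ?_⟩
  · rw [hq]
    exact (hacc.2 s List.not_mem_nil).2
  · by_cases h1 : t = h
    · subst h1
      rw [hq, hvalue _ le_rfl]
      exact (hacc.2 s List.not_mem_nil).1 a
    · have h2 : (h : ℕ) + 1 ≤ t := by
        have : (t : ℕ) ≠ h := fun e => h1 (Fin.ext e)
        omega
      rw [hvalue _ h2, hvalue _ (by omega)]
      exact hst.2 t h2 s a

theorem solvedFrom_horizon (π : Policy S A H) : M.SolvedFrom enc H (π, fun _ => enc 0) :=
  ⟨fun s => by rw [M.value_of_le π le_rfl], fun t ht => by omega⟩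

theorem SolvedFrom.isOptimal {st : Policy S A H × (Fin S → β)} (h : M.SolvedFrom enc 0 st) :
    M.IsOptimal st.1 := fun s => (h.2.optValue_eq s).symm

/-- The loop `h = H - 1, …, 0`: the head of a final part of this list is the length of its tail. -/
theorem eq_length_of_suffix {a : Fin H} {l : List (Fin H)}
    (h : a :: l <:+ (List.finRange H).reverse) : (a : ℕ) = l.length := by
  obtain ⟨t, ht⟩ := h
  have h1 : List.finRange H = l.reverse ++ a :: t.reverse := by
    rw [← List.reverse_reverse (List.finRange H), ← ht]
    simp
  have h2 : (List.finRange H)[l.length]? = some a := by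
    rw [h1, List.getElem?_append_right (by simp)]
    simp
  obtain ⟨h3, h4⟩ := List.getElem?_eq_some_iff.1 h2
  rw [← h4]
  simp

end Invariants

end MDP

/-! ### Classical value iteration -/

namespace CProg

variable {I J α β : Type} (O : I → J)

@[simp] theorem eval_pure (a : α) : (pure a : CProg I J α).eval O = a := rfl

@[simp] theorem queries_pure (a : α) : (pure a : CProg I J α).queries O = 0 := rfl

@[simp] theorem eval_bind (p : CProg I J α) (f : α → CProg I J β) :
    (p >>= f).eval O = (f (p.eval O)).eval O := by
  change (p.bind f).eval O = _
  induction p with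
  | done a => rfl
  | ask i k ih => exact ih (O i)

@[simp] theorem queries_bind (p : CProg I J α) (f : α → CProg I J β) :
    (p >>= f).queries O = p.queries O + (f (p.eval O)).queries O := by
  change (p.bind f).queries O = _
  induction p with
  | done a => simp [bind, queries, eval]
  | ask i k ih => simp [bind, queries, eval, ih, add_right_comm]

/-- A loop over a list preserves an invariant that may depend on the part of the list that is
still to be processed. -/
theorem eval_foldlM {γ : Type} (step : β → γ → CProg I J β) (K : List γ → β → Prop)
    (hstep : ∀ a l b, K (a :: l) b → K l ((step b a).eval O)) (l : List γ) (b : β) (hb : K l b) :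
    K [] ((l.foldlM step b).eval O) := by
  induction l generalizing b with
  | nil => exact hb
  | cons a l ih =>
    rw [List.foldlM_cons, eval_bind]
    exact ih _ (hstep a l b hb)

theorem queries_foldlM {γ : Type} (step : β → γ → CProg I J β) {n : ℕ}
    (hstep : ∀ b a, (step b a).queries O = n) (l : List γ) (b : β) :
    (l.foldlM step b).queries O = l.length * n := by
  induction l generalizing b with
  | nil => simp
  | cons a l ih =>
    rw [List.foldlM_cons, queries_bind, ih, hstep, List.length_cons, Nat.succ_mul, add_comm]

end CProg

section VI

variable {S A H : ℕ} (M : MDP S A H)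

theorem eval_viQ [NeZero S] (V : Fin S → ℝ) (h : Fin H) (s : Fin S) (a : Fin A) :
    (viQ V h s a).eval M.oracle = M.qval V h s a := by
  -- The first component of the accumulator is the reward as soon as one query has been made.
  have key := CProg.eval_foldlM M.oracle
    (fun (acc : ℝ × ℝ) x => (CProg.ask (s, a, h, x) (fun j => CProg.done (j.1, acc.2 + j.2 * V x)) :
      CProg (Fin S × Fin A × Fin H × Fin S) (ℝ × ℝ) (ℝ × ℝ)))
    (fun l acc => acc.2 + (l.map fun x => M.P h s a x * V x).sum = ∑ x, M.P h s a x * V x ∧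
      (l.length < S → acc.1 = M.r h s a))
    (fun x l acc hacc => ⟨by
      rw [← hacc.1, List.map_cons, List.sum_cons, ← add_assoc]
      rfl, fun _ => rfl⟩)
    (List.finRange S) (0, 0) ⟨by rw [Fin.sum_univ_def, zero_add], by simp⟩
  simp only [List.map_nil, List.sum_nil, add_zero, List.length_nil, NeZero.pos S,
    forall_const] at key
  rw [viQ, CProg.eval_bind, CProg.eval_pure, key.1, key.2, MDP.qval]

theorem queries_viQ (V : Fin S → ℝ) (h : Fin H) (s : Fin S) (a : Fin A) :
    (viQ V h s a).queries M.oracle = S := by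
  rw [viQ, CProg.queries_bind, CProg.queries_foldlM _ _ (n := 1) fun _ _ => rfl]
  simp

variable [NeZero A]

theorem le_argmax (f : Fin A → ℝ) (a : Fin A) : f a ≤ f (argmax f) :=
  (Finite.exists_max f).choose_spec a

theorem queries_viStep (h : Fin H) (st : Policy S A H × (Fin S → ℝ)) :
    (viStep h st).queries M.oracle = S * (A * S) := by
  rw [viStep, CProg.queries_foldlM _ _ (n := A * S)]
  · simp
  · intro acc s
    rw [CProg.queries_bind, CProg.queries_foldlM _ _ (n := S)]
    · simp
    · intro Q a
      simp [queries_viQ]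

theorem queries_classicalVI : (classicalVI S A H).queries M.oracle = S ^ 2 * A * H := by
  rw [classicalVI, CProg.queries_foldlM _ _ (n := S * (A * S)) fun st h => queries_viStep M h st]
  simp
  ring

variable {M}

theorem eval_viStep [NeZero S] {h : Fin H} {st : Policy S A H × (Fin S → ℝ)}
    (hst : M.SolvedFrom id (h + 1) st) :
    M.SolvedFrom id h ((viStep h st).eval M.oracle) := by
  have hV : st.2 = M.value st.1 (h + 1) := funext hst.1
  refine MDP.StepInvariant.solvedFrom ?_ hst
  refine CProg.eval_foldlM M.oracle _ (M.StepInvariant id st.1 h) (fun s l acc hacc => ?_) _ _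
    (MDP.stepInvariant_finRange h st)
  have hQ : ((List.finRange A).foldlM (fun (Q : Fin A → ℝ) a => do
      let v ← viQ st.2 h s a
      pure (Function.update Q a v)) (fun _ => 0)).eval M.oracle =
        M.qval (M.value st.1 (h + 1)) h s := by
    have key := CProg.eval_foldlM M.oracle (fun (Q : Fin A → ℝ) a => (do
        let v ← viQ st.2 h s a
        pure (Function.update Q a v) : CProg (Fin S × Fin A × Fin H × Fin S) (ℝ × ℝ) _))
      (fun l Q => ∀ a, a ∉ l → Q a = M.qval (M.value st.1 (h + 1)) h s a)
      (fun a l Q hQ b hb => by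
        rw [CProg.eval_bind, CProg.eval_pure, eval_viQ, hV]
        by_cases hba : b = a
        · subst hba
          simp
        · simpa [hba] using hQ b (by simp [hba, hb]))
      (List.finRange A) (fun _ => 0) (fun a ha => absurd (List.mem_finRange a) ha)
    exact funext fun a => key a List.not_mem_nil
  rw [CProg.eval_bind, CProg.eval_pure, hQ]
  exact hacc.update (le_argmax _)

theorem eval_classicalVI [NeZero S] (M : MDP S A H) :
    M.SolvedFrom id 0 ((classicalVI S A H).eval M.oracle) := by
  have key := CProg.eval_foldlM M.oracle (fun st h => viStep h st)
    (fun l st => l <:+ (List.finRange H).reverse ∧ M.SolvedFrom id l.length st)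
    (fun h l st hst => ⟨(List.suffix_cons h l).trans hst.1, by
      rw [← MDP.eq_length_of_suffix hst.1]
      refine eval_viStep ?_
      rw [MDP.eq_length_of_suffix hst.1]
      exact hst.2⟩)
    (List.finRange H).reverse (fun _ _ => 0, fun _ => 0)
    ⟨List.suffix_rfl, by simpa using MDP.solvedFrom_horizon (M := M) (enc := id) fun _ _ => 0⟩
  exact key.2

end VI

/-! ### Exactness of the arithmetic on words -/

section Words

variable {S A H p q : ℕ}

theorem toWord_add (q m n : ℕ) : toWord q (m + n) = toWord q m + toWord q n := by
  apply Fin.ext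
  simp [toWord, Fin.val_add, Nat.add_mod]

theorem toWord_zero (q : ℕ) : toWord q 0 = 0 := by
  apply Fin.ext
  simp [toWord]

theorem toWord_sum {ι : Type} (q : ℕ) (s : Finset ι) (f : ι → ℕ) :
    toWord q (∑ i ∈ s, f i) = ∑ i ∈ s, toWord q (f i) := by
  classical
  induction s using Finset.induction_on with
  | empty => simp [toWord_zero]
  | insert a s ha ih => rw [Finset.sum_insert ha, Finset.sum_insert ha, toWord_add, ih]

theorem fix_zero (p q : ℕ) : fix p q 0 = 0 := by
  rw [fix, zero_mul, Nat.floor_zero, toWord_zero]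

theorem fix_eq_toWord {x : ℝ} {n : ℕ} (h : x * 2 ^ p = n) : fix p q x = toWord q n := by
  rw [fix, h, Nat.floor_natCast]

theorem mul_two_pow_eq_val_fix {x : ℝ} (h : Representable p q x) :
    x * 2 ^ p = ((fix p q x : ℕ) : ℝ) := by
  have h2 : (2 : ℝ) ^ p ≠ 0 := by positivity
  conv_lhs => rw [← unfix_fix h, unfix, div_mul_cancel₀ _ h2]

theorem representable_of_mul_two_pow_eq {x : ℝ} {n : ℕ} (h : x * 2 ^ p = n) (hn : n < 2 ^ q) :
    Representable p q x := by
  have h2 : (2 : ℝ) ^ p ≠ 0 := by positivity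
  exact ⟨⟨n, hn⟩, by rw [unfix, eq_div_iff h2, h]⟩

/-- Numbers in `[0, H]` with at most `p * H` fractional bits fit into the registers for `V̂`
and `Q̂`. -/
theorem representable_wordBits {x : ℝ} {k n : ℕ} (hk : k ≤ H) (hx : x * 2 ^ (p * k) = n)
    (hxH : x ≤ H) : Representable (fracBits H p) (wordBits H p) x := by
  have hsplit : p * H = p * k + p * (H - k) := by rw [← mul_add, Nat.add_sub_cancel' hk]
  have h1 : x * 2 ^ (p * H) = ((n * 2 ^ (p * (H - k)) : ℕ) : ℝ) := by
    rw [hsplit, pow_add, ← mul_assoc, hx]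
    push_cast
    ring
  refine representable_of_mul_two_pow_eq h1 ?_
  have h2 : ((n * 2 ^ (p * (H - k)) : ℕ) : ℝ) < ((2 ^ (p * H + H) : ℕ) : ℝ) := by
    rw [← h1, pow_add, mul_comm]
    push_cast
    gcongr
    exact hxH.trans_lt (by exact_mod_cast Nat.lt_two_pow_self)
  exact_mod_cast h2

variable {M : MDP S A H}

theorem MDP.exists_qval_mul_two_pow (hM : M.Representable p q) {V : Fin S → ℝ} {m : ℕ}
    (hV : ∀ s, ∃ n : ℕ, V s * 2 ^ (p * m) = n) (h : Fin H) (s : Fin S) (a : Fin A) :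
    ∃ n : ℕ, M.qval V h s a * 2 ^ (p * (m + 1)) = n := by
  choose n hn using hV
  refine ⟨(fix p q (M.r h s a) : ℕ) * 2 ^ (p * m) + ∑ x, (fix p q (M.P h s a x) : ℕ) * n x, ?_⟩
  push_cast
  rw [← mul_two_pow_eq_val_fix (hM.1 h s a), MDP.qval, add_mul, Finset.sum_mul]
  congr 1
  · ring
  · refine Finset.sum_congr rfl fun x _ => ?_
    rw [← mul_two_pow_eq_val_fix (hM.2 h s a x), ← hn]
    ring

theorem MDP.exists_value_mul_two_pow (hM : M.Representable p q) (π : Policy S A H) (h : ℕ) :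
    ∀ s, ∃ n : ℕ, M.value π h s * 2 ^ (p * (H - h)) = n := by
  induction h using MDP.backward_induction (H := H) with
  | hend h hh => exact fun s => ⟨0, by simp [M.value_of_le π hh]⟩
  | hstep h ih =>
    intro s
    rw [M.value_eq_qval, show H - (h : ℕ) = H - (h + 1) + 1 by omega]
    exact MDP.exists_qval_mul_two_pow hM ih h s _

theorem MDP.representable_value (hM : M.Representable p q) (π : Policy S A H) (h : ℕ)
    (s : Fin S) : QVI.Representable (fracBits H p) (wordBits H p) (M.value π h s) := by
  obtain ⟨n, hn⟩ := MDP.exists_value_mul_two_pow hM π h s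
  exact representable_wordBits (Nat.sub_le H h) hn
    ((M.value_le π h s).trans (by exact_mod_cast Nat.sub_le H h))

theorem MDP.representable_qval (hM : M.Representable p q) (π : Policy S A H) (h : Fin H)
    (s : Fin S) (a : Fin A) : QVI.Representable (fracBits H p) (wordBits H p)
      (M.qval (M.value π (h + 1)) h s a) := by
  obtain ⟨n, hn⟩ := MDP.exists_qval_mul_two_pow hM (MDP.exists_value_mul_two_pow hM π (h + 1)) h s a
  refine representable_wordBits (by omega) hn ((M.qval_le (M.value_le π (h + 1)) h s a).trans ?_)
  have : H - ((h : ℕ) + 1) + 1 ≤ H := by omega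
  exact_mod_cast this

/-- The words that `oracleQ` adds up give the word of `Q̂_{h,s}(a)`; in particular the division
by `2 ^ p` in every product is exact. -/
theorem MDP.sum_words_eq_fix_qval (hM : M.Representable p q) (π : Policy S A H) (h : Fin H)
    (s : Fin S) (a : Fin A) :
    (∑ x, toWord (wordBits H p) ((fix p q (M.P h s a x) : ℕ) *
        (fix (fracBits H p) (wordBits H p) (M.value π (h + 1) x) : ℕ) / 2 ^ p)) +
      toWord (wordBits H p) ((fix p q (M.r h s a) : ℕ) * 2 ^ (fracBits H p - p)) =
    fix (fracBits H p) (wordBits H p) (M.qval (M.value π (h + 1)) h s a) := by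
  have hH : p * H = p + (p * H - p) :=
    (Nat.add_sub_cancel' (Nat.le_mul_of_pos_right p h.pos)).symm
  rw [← toWord_sum, ← toWord_add]
  refine (fix_eq_toWord ?_).symm
  rw [MDP.qval, add_mul, Finset.sum_mul, add_comm]
  push_cast
  congr 1
  · refine Finset.sum_congr rfl fun x _ => ?_
    have hV := mul_two_pow_eq_val_fix (MDP.representable_value hM π (h + 1) x)
    have hP := mul_two_pow_eq_val_fix (hM.2 h s a x)
    set v := (fix (fracBits H p) (wordBits H p) (M.value π (h + 1) x) : ℕ)
    set k := (fix p q (M.P h s a x) : ℕ)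
    obtain ⟨n, hn⟩ := MDP.exists_value_mul_two_pow hM π (h + 1) x
    have hdvd : 2 ^ p ∣ k * v := by
      have : v = 2 ^ p * (n * 2 ^ (p * h)) := by
        have e : p * H = p * (H - (h + 1)) + (p + p * h) := by
          have : H = H - (h + 1) + (1 + h) := by omega
          conv_lhs => rw [this]
          ring
        have h1 : (v : ℝ) = ((2 ^ p * (n * 2 ^ (p * h)) : ℕ) : ℝ) := by
          rw [← hV, fracBits, e, pow_add, pow_add, ← mul_assoc, hn]
          push_cast
          ring
        exact_mod_cast h1
      exact Dvd.dvd.mul_left ⟨_, this⟩ k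
    rw [Nat.cast_div hdvd (by positivity)]
    push_cast
    rw [← hP, ← hV]
    field_simp
  · rw [← mul_two_pow_eq_val_fix (hM.1 h s a), fracBits, mul_assoc, ← pow_add, ← hH]

end Words

/-! ### The oracle of `Q̂` -/

section OracleQ

variable {S A H p q : ℕ}

theorem apply_perm_single {R W : Type} [Fintype R] [DecidableEq R] [DecidableEq W]
    (O : Matrix.unitaryGroup R ℂ) (σ : Equiv.Perm W) (w : W) :
    Gate.apply O (.perm σ) (Pi.single w 1) = Pi.single (σ w) 1 := by
  funext w'
  simp [Gate.apply, Pi.single_apply, Equiv.symm_apply_eq]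

variable {M : MDP S A H} {O : Matrix.unitaryGroup (MReg S A H q) ℂ}

theorem query_mregs_single (hO : IsQuantumOracle p q M O) (z : QReg A H p) (s : Fin S)
    (a : Fin A) (h : Fin H) (x : Fin S) (v : Word (wordBits H p)) :
    Gate.apply O (.query mregs) (Pi.single (z, ((s, a, h, x, 0, 0), v)) 1) =
      Pi.single (z, ((s, a, h, x, fix p q (M.r h s a), fix p q (M.P h s a x)), v)) 1 :=
  applyOn_single mregs (hO s a h x) rfl

theorem queryInv_mregs_single (hO : IsQuantumOracle p q M O) (z : QReg A H p) (s : Fin S)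
    (a : Fin A) (h : Fin H) (x : Fin S) (v : Word (wordBits H p)) :
    Gate.apply O (.queryInv mregs)
      (Pi.single (z, ((s, a, h, x, fix p q (M.r h s a), fix p q (M.P h s a x)), v)) 1) =
      Pi.single (z, ((s, a, h, x, 0, 0), v)) 1 := by
  rw [← query_mregs_single hO]
  exact Gate.inv_apply_apply O (.query mregs) _

/-- The unitary `|a⟩|y⟩ ↦ |a⟩|y + F a⟩`. -/
noncomputable def adder {n : ℕ} (F : Fin A → Word n) :
    Matrix.unitaryGroup (Fin A × Word n) ℂ :=
  ⟨Matrix.of fun i j => if i = (j.1, j.2 + F j.1) then 1 else 0, by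
    rw [Matrix.mem_unitaryGroup_iff']
    ext ⟨a, y⟩ ⟨b, z⟩
    simp only [Matrix.mul_apply, Matrix.star_apply, Matrix.of_apply, apply_ite star, star_one,
      star_zero, mul_ite, mul_one, mul_zero, Finset.sum_ite_eq', Finset.mem_univ, if_true,
      Matrix.one_apply]
    congr 1
    by_cases hab : a = b
    · subst hab
      simp [eq_comm]
    · simp [hab, Ne.symm hab]⟩

theorem adder_mulVec_single {n : ℕ} (F : Fin A → Word n) (a : Fin A) (y : Word n) :
    (adder F).1.mulVec (Pi.single (a, y) 1) = Pi.single (a, y + F a) 1 := by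
  funext i
  simp [adder, Pi.single_apply]

variable [NeZero S] [NeZero A] [NeZero H]

theorem load_aux0 (s : Fin S) (h : Fin H) (x : Fin S) (a : Fin A) (y : Word (wordBits H p)) :
    load s h x ((a, y), aux0 S A H p q) = ((a, y), ((s, a, h, x, 0, 0), 0)) := by
  simp [load, loadFun, aux0]

theorem load_symm_aux0 (s : Fin S) (h : Fin H) (x : Fin S) (a : Fin A)
    (y : Word (wordBits H p)) :
    (load s h x).symm ((a, y), ((s, a, h, x, 0, 0), 0)) = ((a, y), aux0 S A H p q) := by
  rw [Equiv.symm_apply_eq, load_aux0]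

/-- The content of the output word, as computed by `oracleQ` from the output word `0`. -/
noncomputable def wordQ (p q : ℕ) (M : MDP S A H) (V : Fin S → Word (wordBits H p)) (h : Fin H)
    (s : Fin S) (a : Fin A) : Word (wordBits H p) :=
  (∑ x, toWord _ ((fix p q (M.P h s a x) : ℕ) * (V x : ℕ) / 2 ^ p)) +
    toWord _ ((fix p q (M.r h s a) : ℕ) * 2 ^ (fracBits H p - p))

theorem oracleQ_single (hO : IsQuantumOracle p q M O) (V : Fin S → Word (wordBits H p))
    (h : Fin H) (s : Fin S) (a : Fin A) (y : Word (wordBits H p)) :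
    Circuit.apply O (oracleQ V h s) (Pi.single ((a, y), aux0 S A H p q) 1) =
      Pi.single ((a, y + wordQ p q M V h s a), aux0 S A H p q) 1 := by
  have hsum : ∀ (l : List (Fin S)) (y : Word (wordBits H p)), Circuit.apply O
      (l.flatMap fun x => [.perm (load s h x), .query mregs, .perm (oracleV V), .perm mulAdd,
        .perm (oracleV V).symm, .queryInv mregs, .perm (load s h x).symm])
      (Pi.single ((a, y), aux0 S A H p q) 1) =
        Pi.single ((a, y + (l.map fun x => toWord (wordBits H p)
          ((fix p q (M.P h s a x) : ℕ) * (V x : ℕ) / 2 ^ p)).sum), aux0 S A H p q) 1 := by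
    intro l
    induction l with
    | nil => exact fun y => by simp
    | cons x l ih =>
      intro y
      rw [List.flatMap_cons, Circuit.apply_append, List.map_cons, List.sum_cons, ← add_assoc,
        ← ih]
      congr 1
      simp only [Circuit.apply_cons, Circuit.apply_nil]
      rw [apply_perm_single, load_aux0, query_mregs_single hO, apply_perm_single,
        apply_perm_single, apply_perm_single]
      have : (oracleV V).symm (mulAdd (oracleV V ((a, y),
          ((s, a, h, x, fix p q (M.r h s a), fix p q (M.P h s a x)), 0)))) =
          ((a, y + toWord (wordBits H p) ((fix p q (M.P h s a x) : ℕ) * (V x : ℕ) / 2 ^ p)),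
          ((s, a, h, x, fix p q (M.r h s a), fix p q (M.P h s a x)), 0)) := by
        simp [oracleV, mulAdd]
      rw [this, queryInv_mregs_single hO, apply_perm_single, load_symm_aux0]
  rw [oracleQ, Circuit.apply_append, hsum, ← Fin.sum_univ_def]
  simp only [Circuit.apply_cons, Circuit.apply_nil]
  rw [apply_perm_single, load_aux0, query_mregs_single hO, apply_perm_single]
  change Gate.apply O (.perm (load s h 0).symm) (Gate.apply O (.queryInv mregs)
    (Pi.single ((a, _), ((s, a, h, 0, fix p q (M.r h s a), fix p q (M.P h s a 0)), 0)) 1)) = _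
  rw [queryInv_mregs_single hO, apply_perm_single, load_symm_aux0, wordQ, add_assoc]

theorem oracleQ_withAux (hO : IsQuantumOracle p q M O) (V : Fin S → Word (wordBits H p))
    (h : Fin H) (s : Fin S) (φ : QReg A H p → ℂ) :
    Circuit.apply O (oracleQ V h s) (withAux (aux0 S A H p q) φ) =
      withAux (aux0 S A H p q) ((adder (wordQ p q M V h s)).1.mulVec φ) := by
  have hdecomp : ∀ ψ : QReg A H p → ℂ, withAux (aux0 S A H p q) ψ =
      ∑ z, ψ z • (Pi.single (z, aux0 S A H p q) 1 : QReg A H p × Aux S A H p q → ℂ) := by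
    intro ψ
    funext ⟨z, u⟩
    rw [Finset.sum_apply, Finset.sum_eq_single z]
    · by_cases hu : u = aux0 S A H p q <;> simp [withAux, hu]
    · intro z' _ hz'
      simp [Ne.symm hz']
    · simp
  obtain ⟨L, hL⟩ := Circuit.exists_linearMap O (oracleQ (S := S) (A := A) (q := q) V h s)
  have hφ : φ = ∑ z, φ z • (Pi.single z 1 : QReg A H p → ℂ) := by
    funext z
    simp [Finset.sum_apply, Pi.single_apply]
  have hlin : ∀ ψ : QReg A H p → QReg A H p → ℂ, withAux (aux0 S A H p q) (∑ z, φ z • ψ z) =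
      ∑ z, φ z • withAux (aux0 S A H p q) (ψ z) := by
    intro ψ
    funext ⟨z, u⟩
    by_cases hu : u = aux0 S A H p q <;> simp [withAux, hu, Finset.sum_apply]
  rw [hL, hdecomp, map_sum]
  conv_rhs => rw [hφ, Matrix.mulVec_sum]
  simp only [Matrix.mulVec_smul]
  rw [hlin]
  refine Finset.sum_congr rfl fun z _ => ?_
  obtain ⟨a, y⟩ := z
  rw [map_smul, ← hL, oracleQ_single hO, adder_mulVec_single, withAux_single]

theorem cost_oracleQ (V : Fin S → Word (wordBits H p)) (h : Fin H) (s : Fin S) :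
    Circuit.cost (oracleQ (S := S) (A := A) (q := q) V h s) = S * 2 + 2 := by
  have hsum : ∀ l : List (Fin S), Circuit.cost (R := MReg S A H q)
      (W := QReg A H p × Aux S A H p q)
      (l.flatMap fun x => [.perm (load s h x), .query mregs, .perm (oracleV V), .perm mulAdd,
        .perm (oracleV V).symm, .queryInv mregs, .perm (load s h x).symm]) = l.length * 2 := by
    intro l
    induction l with
    | nil => rfl
    | cons x l ih =>
      rw [List.flatMap_cons, Circuit.cost_append, ih, List.length_cons, Nat.succ_mul, add_comm]
      rfl
  rw [oracleQ, Circuit.cost_append, hsum, List.length_finRange]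
  rfl

theorem prob_evalQ_bind (hO : IsQuantumOracle p q M O) (V : Fin S → Word (wordBits H p))
    (h : Fin H) (s : Fin S) (a : Fin A) {β : Type}
    (f : Word (wordBits H p) → Prog (MReg S A H q) β) (E : Set β) :
    ((evalQ V h s a).bind f).prob O E = (f (wordQ p q M V h s a)).prob O E := by
  rw [evalQ, Prog.bind, Prog.prob,
    Finset.sum_eq_single ((a, wordQ p q M V h s a), aux0 S A H p q)]
  · rw [oracleQ_single hO, zero_add]
    simp [Prog.bind]
  · intro w _ hw
    rw [oracleQ_single hO, zero_add]
    simp [hw]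
  · simp

end OracleQ

/-! ### Correctness and query complexity of QVI-1 -/

section QVI1

variable {S A H p q : ℕ} [NeZero S] [NeZero A] [NeZero H] {QMS : MaxSearch} {c : ℝ}

section Correctness

variable {M : MDP S A H} {O : Matrix.unitaryGroup (MReg S A H q) ℂ}

theorem le_prob_qviStep (hQMS : IsQMS QMS c) (hM : M.Representable p q)
    (hO : IsQuantumOracle p q M O) {ζ : ℝ} (h0 : 0 < ζ) (h1 : ζ < 1) (h : Fin H)
    {st : Policy S A H × (Fin S → Word (wordBits H p))}
    (hst : M.SolvedFrom (fix (fracBits H p) (wordBits H p)) (h + 1) st) :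
    1 - S * ζ ≤ (qviStep QMS ζ h st).prob O
      {st' | M.SolvedFrom (fix (fracBits H p) (wordBits H p)) h st'} := by
  have hV : st.2 = fun s => fix (fracBits H p) (wordBits H p) (M.value st.1 (h + 1) s) :=
    funext hst.1
  have hword : ∀ s a, wordQ p q M st.2 h s a =
      fix (fracBits H p) (wordBits H p) (M.qval (M.value st.1 (h + 1)) h s a) := fun s a => by
    rw [hV]
    exact MDP.sum_words_eq_fix_qval hM st.1 h s a
  have key := Prog.le_prob_foldlM O
    (fun (acc : Policy S A H × (Fin S → Word (wordBits H p))) s => (do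
      let a ← (QMS A (wordBits H p) ζ).subst (oracleQ st.2 h s) (aux0 S A H p q)
      let v ← evalQ st.2 h s a
      pure (Function.update acc.1 s (Function.update (acc.1 s) h a),
        Function.update acc.2 s v) : Prog (MReg S A H q) _))
    (M.StepInvariant (fix (fracBits H p) (wordBits H p)) st.1 h) h0.le
    (fun s l acc hacc => ?_) (List.finRange S) st (MDP.stepInvariant_finRange h st)
  · rw [List.length_finRange] at key
    exact key.trans (Prog.prob_mono _ _ fun acc hacc => MDP.StepInvariant.solvedFrom hacc hst)
  · have hsearch := (hQMS.2 A (wordBits H p) ζ h0 h1).2 (fracBits H p)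
      (M.qval (M.value st.1 (h + 1)) h s) (fun a => MDP.representable_qval hM st.1 h s a)
      (adder (wordQ p q M st.2 h s)) (fun a => by rw [adder_mulVec_single, zero_add, hword])
    rw [← Prog.prob_subst (oracleQ_withAux hO st.2 h s)] at hsearch
    have := Prog.le_prob_bind O _ (fun a => (evalQ st.2 h s a).bind fun v =>
        .done (Function.update acc.1 s (Function.update (acc.1 s) h a),
          Function.update acc.2 s v))
      (E := {acc' | M.StepInvariant (fix (fracBits H p) (wordBits H p)) st.1 h l acc'})
      (y := 0) le_rfl hsearch (fun a ha => by
        rw [prob_evalQ_bind hO, hword, sub_zero]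
        exact (Prog.prob_done_of_mem O (hacc.update ha)).ge)
    rw [add_zero] at this
    exact this

theorem le_prob_QVI1 (hQMS : IsQMS QMS c) (hM : M.Representable p q)
    (hO : IsQuantumOracle p q M O) {δ : ℝ} (h0 : 0 < δ) (h1 : δ < 1) :
    1 - δ ≤ (QVI1 S A H p q QMS δ).prob O (correctOutputs M) := by
  have hS : (1 : ℝ) ≤ S := Nat.one_le_cast.2 (NeZero.pos S)
  have hH : (1 : ℝ) ≤ H := Nat.one_le_cast.2 (NeZero.pos H)
  have hSH : (1 : ℝ) ≤ S * H := one_le_mul_of_one_le_of_one_le hS hH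
  have hζ0 : 0 < δ / (S * H) := by positivity
  have hζ1 : δ / (S * H) < 1 := (div_le_self h0.le hSH).trans_lt h1
  have key := Prog.le_prob_foldlM O (fun st h => qviStep QMS (δ / (S * H)) h st)
    (fun (l : List (Fin H)) (st : Policy S A H × (Fin S → Word (wordBits H p))) =>
      l <:+ (List.finRange H).reverse ∧
        M.SolvedFrom (fix (fracBits H p) (wordBits H p)) l.length st)
    (x := S * (δ / (S * H))) (by positivity)
    (fun h l st hst => by
      have hlen := MDP.eq_length_of_suffix hst.1
      have hst2 := hst.2
      rw [List.length_cons, ← hlen] at hst2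
      refine (le_prob_qviStep hQMS hM hO hζ0 hζ1 h hst2).trans (Prog.prob_mono _ _ ?_)
      exact fun st' hst' => ⟨(List.suffix_cons h l).trans hst.1, hlen ▸ hst'⟩)
    (List.finRange H).reverse (fun _ _ => 0, fun _ => 0)
    ⟨List.suffix_rfl, by
      simpa [fix_zero] using MDP.solvedFrom_horizon (M := M)
        (enc := fix (fracBits H p) (wordBits H p)) fun _ _ => 0⟩
  have hlength : 1 - ((List.finRange H).reverse.length : ℝ) * (S * (δ / (S * H))) = 1 - δ := by
    rw [List.length_reverse, List.length_finRange]
    field_simp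
  rw [hlength] at key
  refine key.trans (Prog.prob_mono _ _ fun st hst => ?_)
  refine ⟨hst.2.isOptimal, fun s => ?_⟩
  rw [hst.2.1 s, unfix_fix (MDP.representable_value hM _ _ s)]
  exact (hst.2.2.optValue_eq s).symm

end Correctness

theorem queries_QVI1_le (QMS : MaxSearch) (δ : ℝ) :
    (QVI1 S A H p q QMS δ).queries ≤
      H * (S * (((QMS A (wordBits H p) (δ / (S * H))).queries + 1) * (S * 2 + 2))) := by
  have hstep : ∀ st h, (qviStep (S := S) (A := A) (H := H) (p := p) (q := q) QMS
      (δ / (S * H)) h st).queries ≤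
        S * (((QMS A (wordBits H p) (δ / (S * H))).queries + 1) * (S * 2 + 2)) := by
    intro st h
    refine (Prog.queries_foldlM_le _ (n := ((QMS A (wordBits H p) (δ / (S * H))).queries + 1) *
      (S * 2 + 2)) (fun acc s => ?_) _ _).trans (by rw [List.length_finRange])
    refine (Prog.queries_bind_le _ _ (n := S * 2 + 2) fun a => ?_).trans ?_
    · refine (Prog.queries_bind_le _ _ (n := 0) fun v => le_rfl).trans ?_
      simp [evalQ, Prog.queries, cost_oracleQ]
    · have := Prog.queries_subst_le (oracleQ (q := q) st.2 h s) (aux0 S A H p q)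
        (QMS A (wordBits H p) (δ / (S * H)))
      rw [cost_oracleQ] at this
      rw [add_mul, one_mul]
      exact Nat.add_le_add_right this _
  refine (Prog.queries_foldlM_le _ hstep _ _).trans ?_
  rw [List.length_reverse, List.length_finRange]

theorem queries_QVI1_le_log (hQMS : IsQMS QMS c) {κ : ℝ} (hκ : 1 < κ) {δ : ℝ} (h0 : 0 < δ)
    (h1 : δ < 1) (hδ : κ ≤ (S : ℝ) * H / δ) :
    ((QVI1 S A H p q QMS δ).queries : ℝ) ≤ 4 * (c + 1) * max 1 (Real.log κ)⁻¹ *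
      ((S : ℝ) ^ 2 * √(A : ℝ) * H * Real.log ((S : ℝ) * H / δ)) := by
  have hS : (1 : ℝ) ≤ S := Nat.one_le_cast.2 (NeZero.pos S)
  have hH : (1 : ℝ) ≤ H := Nat.one_le_cast.2 (NeZero.pos H)
  have hA : (1 : ℝ) ≤ √(A : ℝ) := Real.one_le_sqrt.2 (Nat.one_le_cast.2 (NeZero.pos A))
  have hSH : (1 : ℝ) ≤ S * H := one_le_mul_of_one_le_of_one_le hS hH
  have hζ0 : 0 < δ / (S * H) := by positivity
  have hζ1 : δ / (S * H) < 1 := (div_le_self h0.le hSH).trans_lt h1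
  have hc := hQMS.1
  have hq := (hQMS.2 A (wordBits H p) _ hζ0 hζ1).1
  rw [one_div_div] at hq
  set ℓ := Real.log (S * H / δ) with hℓ
  have hlogκ : 0 < Real.log κ := Real.log_pos hκ
  have hℓκ : Real.log κ ≤ ℓ := Real.log_le_log (by linarith) hδ
  set D := max 1 (Real.log κ)⁻¹ with hD
  have hℓ0 : 0 < ℓ := hlogκ.trans_le hℓκ
  have h1D : 1 ≤ D * ℓ := by
    calc (1 : ℝ) = (Real.log κ)⁻¹ * Real.log κ := (inv_mul_cancel₀ hlogκ.ne').symm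
      _ ≤ D * ℓ := by
        gcongr
        exact le_max_right _ _
  have hmax : max 1 ℓ ≤ D * ℓ := max_le h1D (le_mul_of_one_le_left hℓ0.le (le_max_left _ _))
  have hn : ((QMS A (wordBits H p) (δ / (S * H))).queries : ℝ) + 1 ≤
      (c + 1) * √(A : ℝ) * (D * ℓ) := by
    have e1 : c * √(A : ℝ) * max 1 ℓ ≤ c * √(A : ℝ) * (D * ℓ) := by gcongr
    have e2 : (1 : ℝ) ≤ √(A : ℝ) * (D * ℓ) := one_le_mul_of_one_le_of_one_le hA h1D
    linarith
  have hS2 : (S : ℝ) * 2 + 2 ≤ 4 * S := by linarith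
  calc ((QVI1 S A H p q QMS δ).queries : ℝ)
      ≤ H * (S * (((QMS A (wordBits H p) (δ / (S * H))).queries + 1) * (S * 2 + 2))) := by
        exact_mod_cast queries_QVI1_le QMS δ
    _ ≤ H * (S * ((c + 1) * √(A : ℝ) * (D * ℓ) * (4 * S))) := by gcongr
    _ = _ := by ring

end QVI1

end QVI

theorem mainTheorem3 :
    ∃ (QMS : QVI.MaxSearch) (c : ℝ), QVI.IsQMS QMS c ∧
      -- query complexity of QVI-1
      (∀ κ : ℝ, 1 < κ → ∃ C : ℝ, 0 < C ∧
        ∀ (S A H : ℕ) [NeZero S] [NeZero A] [NeZero H] (p q : ℕ) (δ : ℝ), 0 < δ → δ < 1 →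
          κ ≤ (S : ℝ) * H / δ →
          ((QVI.QVI1 S A H p q QMS δ).queries : ℝ) ≤
            C * ((S : ℝ) ^ 2 * √(A : ℝ) * H * Real.log ((S : ℝ) * H / δ))) ∧
      -- QVI-1 computes an optimal policy and the optimal values
      (∀ (S A H : ℕ) [NeZero S] [NeZero A] [NeZero H] (p q : ℕ) (δ : ℝ), 0 < δ → δ < 1 →
        ∀ M : QVI.MDP S A H, M.Representable p q →
          ∀ O : Matrix.unitaryGroup (QVI.MReg S A H q) ℂ, QVI.IsQuantumOracle p q M O →
            1 - δ ≤ (QVI.QVI1 S A H p q QMS δ).prob O (QVI.correctOutputs M)) ∧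
      -- classical value iteration, for comparison
      (∀ (S A H : ℕ) [NeZero S] [NeZero A] [NeZero H] (M : QVI.MDP S A H),
        (QVI.classicalVI S A H).queries M.oracle = S ^ 2 * A * H ∧
        M.IsOptimal ((QVI.classicalVI S A H).eval M.oracle).1 ∧
        ∀ s, ((QVI.classicalVI S A H).eval M.oracle).2 s = M.optValue 0 s) := by
  refine ⟨QVI.maxSearch, 1033, QVI.isQMS_maxSearch, fun κ hκ =>
    ⟨4 * (1033 + 1) * max 1 (Real.log κ)⁻¹, by positivity, fun S A H _ _ _ p q δ h0 h1 hδ =>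
      QVI.queries_QVI1_le_log QVI.isQMS_maxSearch hκ h0 h1 hδ⟩,
    fun S A H _ _ _ p q δ h0 h1 M hM O hO => QVI.le_prob_QVI1 QVI.isQMS_maxSearch hM hO h0 h1,
    fun S A H _ _ _ M => ⟨QVI.queries_classicalVI M, (QVI.eval_classicalVI M).isOptimal,
      fun s => ?_⟩⟩
  have h := QVI.eval_classicalVI M
  rw [h.1 s]
  exact (h.2.optValue_eq s).symm
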